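/- Let $m\ge 1$, $k\ge 0$ be integers with $N:=k+m\ge 3$, and put $p_N=\frac{2N}{N-2}$, $a_N=\frac{4(N-1)}{N-2}$. Let $(M^k,g)$ be a closed (compact, without boundary, non-empty) smooth Riemannian manifold of constant scalar curvature $s$, and let $g_0^m$ be the metric of constant curvature $1$ on the sphere $S^m$. For a Riemannian metric $h$ on a closed $N$-manifold $X$ let $$S(h)=\frac{\int_X s_h\,dvol_h}{Vol(X,h)^{\frac{N-2}{N}}}$$ be the (normalized) total scalar curvature functional, where $s_h$ and $dvol_h$ are the scalar curvature and the volume element of $h$; a metric $h$ is called a Yamabe metric if it minimizes $S$ over its conformal class $[h]=\{\varphi h:\varphi\in C^\infty(X),\ \varphi>0\}$. If $$s+m(m-1)>\frac{a_N\,m}{p_N-2},$$ then the Riemannian product $g+g_0^m$ on $M\times S^m$ is not a Yamabe metric. Moreover, it is not even a local minimum of $S$ restricted to $\{f\,(g+g_0^m): f\in C^\infty(S^m),\ f>0\}$, where a function on $S^m$ is regarded as a function on $M\times S^m$: every neighbourhood of the constant function $1$ in the $C^\infty$ topology of $C^\infty(S^m)$ contains a positive function $f$ with $S(f\,(g+g_0^m))<S(g+g_0^m)$.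 -/

import Mathlib

set_option maxSynthPendingDepth 3

open Set MeasureTheory Module
open scoped Manifold ContDiff Topology UniformConvergence

noncomputable section

namespace RiemannianYamabe

/-! ### Curvature of a metric on an open set of a vector space

`G : E → E →L[ℝ] E →L[ℝ] ℝ` is a field of bilinear forms on the vector space `E`, for instance a
Riemannian metric read in a chart; only its behaviour near the point `y` matters. -/

section Local

variable {E : Type*} [NormedAddCommGroup E] [NormedSpace ℝ E]

/-- The Christoffel symbols `Γ(v, w)` of `G` at `y`: the vector dual, with respect to `G y`, to
the linear form `z ↦ (1/2) (∂_v G(w, z) + ∂_w G(v, z) - ∂_z G(v, w))`. -/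
def christoffel (G : E → E →L[ℝ] E →L[ℝ] ℝ) (y : E) : E →L[ℝ] E →L[ℝ] E :=
  let D : E →L[ℝ] E →L[ℝ] E →L[ℝ] ℝ := fderiv ℝ G y
  let flip : (E →L[ℝ] E →L[ℝ] ℝ) →L[ℝ] (E →L[ℝ] E →L[ℝ] ℝ) :=
    (ContinuousLinearMap.flipₗᵢ ℝ E E ℝ).toContinuousLinearEquiv
  let K : E →L[ℝ] E →L[ℝ] E →L[ℝ] ℝ := (1 / 2 : ℝ) • (D + D.flip - flip.comp D.flip)
  (ContinuousLinearMap.compL ℝ E (E →L[ℝ] ℝ) E (G y).inverse).comp K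

/-- `christoffel` is given by the formula in its description. -/
theorem christoffel_apply [FiniteDimensional ℝ E] (G : E → E →L[ℝ] E →L[ℝ] ℝ) (y : E)
    (hG : ∀ v, v ≠ 0 → G y v v ≠ 0) (v w z : E) :
    G y (christoffel G y v w) z =
      (1 / 2) * (fderiv ℝ G y v w z + fderiv ℝ G y w v z - fderiv ℝ G y z v w) := by
  have hinj : Function.Injective (G y : E →ₗ[ℝ] (E →L[ℝ] ℝ)) := by
    refine (injective_iff_map_eq_zero _).2 fun a ha => ?_
    by_contra h
    exact hG a h (by simpa using congrArg (fun l : E →L[ℝ] ℝ => l a) ha)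
  have hfin : finrank ℝ E = finrank ℝ (E →L[ℝ] ℝ) := by
    rw [← (LinearMap.toContinuousLinearMap (𝕜 := ℝ) (E := E) (F' := ℝ)).finrank_eq,
      ← Subspace.dual_finrank_eq (K := ℝ) (V := E)]
  let e : E ≃L[ℝ] (E →L[ℝ] ℝ) :=
    (LinearEquiv.ofInjectiveOfFinrankEq (G y : E →ₗ[ℝ] (E →L[ℝ] ℝ)) hinj hfin).toContinuousLinearEquiv
  have he : (G y) = (e : E →L[ℝ] (E →L[ℝ] ℝ)) := by
    ext a b; rfl
  have key : ∀ l : E →L[ℝ] ℝ, G y ((G y).inverse l) = l := by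
    intro l
    rw [he, ContinuousLinearMap.inverse_equiv]
    simp
  have h2 : christoffel G y v w = (G y).inverse ((1 / 2 : ℝ) • (fderiv ℝ G y v w
      + fderiv ℝ G y w v - ((fderiv ℝ G y).flip v).flip w)) := rfl
  rw [h2, key]
  simp

/-- The curvature operator `u ↦ R(u, v) w`, where
`R(u, v) w = (∂_u Γ)(v, w) - (∂_v Γ)(u, w) + Γ(u, Γ(v, w)) - Γ(v, Γ(u, w))`. -/
def curvatureOperator (G : E → E →L[ℝ] E →L[ℝ] ℝ) (y v w : E) : E →ₗ[ℝ] E where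
  toFun u :=
    fderiv ℝ (christoffel G) y u v w - fderiv ℝ (christoffel G) y v u w
      + christoffel G y u (christoffel G y v w) - christoffel G y v (christoffel G y u w)
  map_add' a b := by simp; abel
  map_smul' c a := by simp [smul_sub, smul_add]

/-- The Ricci tensor `Ric(v, w)`: the trace of `u ↦ R(u, v) w`. -/
def ricci (G : E → E →L[ℝ] E →L[ℝ] ℝ) (y : E) : E →ₗ[ℝ] E →ₗ[ℝ] ℝ :=
  LinearMap.mk₂ ℝ (fun v w => LinearMap.trace ℝ E (curvatureOperator G y v w))
    (fun v v' w => by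
      rw [← map_add]; congr 1; ext u; simp [curvatureOperator]; abel)
    (fun c v w => by
      rw [← map_smul]; congr 1; ext u; simp [curvatureOperator, smul_sub, smul_add])
    (fun v w w' => by
      rw [← map_add]; congr 1; ext u; simp [curvatureOperator]; abel)
    (fun c v w => by
      rw [← map_smul]; congr 1; ext u; simp [curvatureOperator, smul_sub, smul_add])

/-- The scalar curvature: the trace of the Ricci tensor with respect to `G y`, that is, the trace
of the endomorphism `v ↦ ♯ Ric(v, ·)`, where `♯` is the inverse of `G y : E → E*`. -/
def scalarCurvatureLocal [FiniteDimensional ℝ E] (G : E → E →L[ℝ] E →L[ℝ] ℝ) (y : E) : ℝ :=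
  LinearMap.trace ℝ E (((G y).inverse : (E →L[ℝ] ℝ) →ₗ[ℝ] E) ∘ₗ
    (LinearMap.toContinuousLinearMap : (E →ₗ[ℝ] ℝ) ≃ₗ[ℝ] (E →L[ℝ] ℝ)).toLinearMap ∘ₗ ricci G y)

/-- The volume density `√det(G_ij)` of `G`, in the coordinates of a basis `b` of `E`. -/
def volumeDensity {ι : Type*} [Fintype ι] [DecidableEq ι] (b : Basis ι ℝ E)
    (G : E → E →L[ℝ] E →L[ℝ] ℝ) (y : E) : ℝ :=
  √(Matrix.of fun i j => G y (b i) (b j)).det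

end Local

/-! ### Riemannian metrics on manifolds without boundary -/

section Manifold

variable {E : Type*} [NormedAddCommGroup E] [NormedSpace ℝ E]
  {H : Type*} [TopologicalSpace H] {I : ModelWithCorners ℝ E H}
  {M : Type*} [TopologicalSpace M] [ChartedSpace H M]
  {E' : Type*} [NormedAddCommGroup E'] [NormedSpace ℝ E']
  {H' : Type*} [TopologicalSpace H'] {J : ModelWithCorners ℝ E' H'}
  {N : Type*} [TopologicalSpace N] [ChartedSpace H' N]

variable (I M) in
/-- Fields of bilinear forms on the tangent spaces of `M`. Riemannian metrics are such fields; the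
functionals below are defined by formulas that make sense for all of them. -/
abbrev FormField : Type _ := ∀ x : M, TangentSpace I x →L[ℝ] TangentSpace I x →L[ℝ] ℝ

/-- The pull-back `f^* g`, with `(f^* g)_x(v, w) = g_{f(x)}(df_x v, df_x w)`. -/
def pullback (I : ModelWithCorners ℝ E H) {J : ModelWithCorners ℝ E' H'}
    (f : M → N) (g : FormField J N) : FormField I M := fun x =>
  let B : E' →L[ℝ] E' →L[ℝ] ℝ := g (f x)
  let L : E →L[ℝ] E' := mfderiv I J f x
  (B.bilinearComp L L : E →L[ℝ] E →L[ℝ] ℝ)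

theorem pullback_apply (f : M → N) (g : FormField J N) (x : M) (v w : TangentSpace I x) :
    pullback I f g x v w = g (f x) (mfderiv I J f x v) (mfderiv I J f x w) := rfl

/-- The Riemannian product `g + h` on `M × N`. -/
def productMetric (g : FormField I M) (h : FormField J N) : FormField (I.prod J) (M × N) :=
  pullback (I.prod J) Prod.fst g + pullback (I.prod J) Prod.snd h

/-- The form field `φ g`, for a function `φ` on `M`. -/
def conformal (φ : M → ℝ) (g : FormField I M) : FormField I M := fun x => φ x • g x

/-- The metric `g` read in the preferred chart at `x₀`, as a field on `E`: its pull-back by the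
inverse of the chart. Only the values on the target of the chart are meaningful. -/
def inChart (g : FormField I M) (x₀ : M) : E → E →L[ℝ] E →L[ℝ] ℝ :=
  (pullback 𝓘(ℝ, E) (extChartAt I x₀).symm g : FormField 𝓘(ℝ, E) E)

/-- The scalar curvature of `g` at `x`, computed in the preferred chart at `x`. -/
def scalarCurvature [FiniteDimensional ℝ E] (g : FormField I M) (x : M) : ℝ :=
  scalarCurvatureLocal (inChart g x) (extChartAt I x x)

/-- The Riemannian measure of the domain of the chart at `x₀`, as a measure on `M`: the image of
`√det(g_ij) dy^1 ⋯ dy^n` on the target of the chart. It does not depend on the basis that defines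
the coordinates `y^i` of `E`. -/
def chartVolume [FiniteDimensional ℝ E] [MeasurableSpace E] [BorelSpace E] [MeasurableSpace M]
    (g : FormField I M) (x₀ : M) : Measure M :=
  (((finBasis ℝ E).addHaar.restrict (extChartAt I x₀).target).withDensity
    (fun y => ENNReal.ofReal (volumeDensity (finBasis ℝ E) (inChart g x₀) y))).map
      (extChartAt I x₀).symm

/-- The Riemannian measure `dvol_g`: the smallest measure that dominates the measures
`chartVolume g x₀`. Since two of these agree on the intersection of the chart domains,
it is the measure whose restriction to each chart domain is `chartVolume g x₀`. -/
def volumeMeasure [FiniteDimensional ℝ E] [MeasurableSpace E] [BorelSpace E] [MeasurableSpace M]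
    (g : FormField I M) : Measure M :=
  ⨆ x₀ : M, chartVolume g x₀

/-- The (normalized) total scalar curvature functional `∫ s_g dvol_g / Vol(M, g)^((n - 2) / n)`,
where `n` is the dimension of `M`. -/
def totalScalarCurvature [FiniteDimensional ℝ E] [MeasurableSpace E] [BorelSpace E]
    [MeasurableSpace M] (g : FormField I M) : ℝ :=
  (∫ x, scalarCurvature g x ∂(volumeMeasure g)) /
    (volumeMeasure g).real univ ^ (((finrank ℝ E : ℝ) - 2) / (finrank ℝ E : ℝ))

/-- The conformal class `[g]`: the metrics `φ g` with `φ` a positive smooth function. -/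
def conformalClass (g : FormField I M) : Set (FormField I M) :=
  {h | ∃ φ : C^∞⟮I, M; ℝ⟯, (∀ x, 0 < φ x) ∧ h = conformal φ g}

/-- A Yamabe metric minimizes the total scalar curvature functional over its conformal class. -/
def IsYamabeMetric [FiniteDimensional ℝ E] [MeasurableSpace E] [BorelSpace E]
    [MeasurableSpace M] (g : FormField I M) : Prop :=
  IsMinOn totalScalarCurvature (conformalClass g) g

/-- The `C^∞` topology on the space of smooth functions on `M`: uniform convergence of the
derivatives of every order, in every (preferred) chart, on the compact subsets of its target. -/
instance smoothTopology : TopologicalSpace C^∞⟮I, M; ℝ⟯ :=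
  ⨅ (x₀ : M) (j : ℕ), TopologicalSpace.induced
    (fun f => UniformOnFun.ofFun {K | IsCompact K ∧ K ⊆ (extChartAt I x₀).target}
      (iteratedFDeriv ℝ j (f ∘ (extChartAt I x₀).symm)))
    inferInstance

/-- The underlying form field of a smooth Riemannian metric. -/
def formField [IsManifold I ∞ M]
    (g : Bundle.ContMDiffRiemannianMetric I ∞ E (fun x : M => TangentSpace I x)) :
    FormField I M := g.inner

end Manifold

/-! ### The round sphere -/

/-- The unit sphere `S^m` in `ℝ^(m+1)`. -/
abbrev Sphere (m : ℕ) : Type := Metric.sphere (0 : EuclideanSpace ℝ (Fin (m + 1))) 1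

/-- The Euclidean metric of `ℝ^n`. -/
def euclideanMetric (n : ℕ) :
    FormField 𝓘(ℝ, EuclideanSpace ℝ (Fin n)) (EuclideanSpace ℝ (Fin n)) := fun _ =>
  (innerSL ℝ : EuclideanSpace ℝ (Fin n) →L[ℝ] EuclideanSpace ℝ (Fin n) →L[ℝ] ℝ)

/-- The metric of constant curvature `1` on `S^m`: the pull-back of the Euclidean metric by the
inclusion of `S^m` into `ℝ^(m+1)`. -/
def roundMetric (m : ℕ) : FormField (𝓡 m) (Sphere m) :=
  pullback (𝓡 m) ((↑) : Sphere m → EuclideanSpace ℝ (Fin (m + 1)))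
    (euclideanMetric (m + 1))

/-- The critical exponent `p_N = 2N / (N - 2)`. -/
def criticalExponent (N : ℕ) : ℝ := 2 * N / (N - 2)

/-- The constant `a_N = 4(N - 1) / (N - 2)`. -/
def yamabeCoefficient (N : ℕ) : ℝ := 4 * (N - 1) / (N - 2)

end RiemannianYamabe

end

noncomputable section

namespace RiemannianYamabe

section LocalCurvature

variable {E : Type*} [NormedAddCommGroup E] [NormedSpace ℝ E]

/-- `G` is a smooth Riemannian metric on a neighbourhood of `y`. -/
structure IsMetricAt (G : E → E →L[ℝ] E →L[ℝ] ℝ) (y : E) : Prop where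
  contDiff : ∀ᶠ z in 𝓝 y, ContDiffAt ℝ ∞ G z
  symm : ∀ᶠ z in 𝓝 y, ∀ v w, G z v w = G z w v
  pos : ∀ᶠ z in 𝓝 y, ∀ v, v ≠ 0 → 0 < G z v v

/-- The gradient of `u` with respect to `G`. -/
def gradientLocal (G : E → E →L[ℝ] E →L[ℝ] ℝ) (u : E → ℝ) (z : E) : E :=
  (G z).inverse (fderiv ℝ u z)

/-- The covariant derivative `v ↦ ∇_v X` of a vector field `X`. -/
def covariantDeriv (G : E → E →L[ℝ] E →L[ℝ] ℝ) (X : E → E) (y : E) : E →ₗ[ℝ] E :=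
  ((fderiv ℝ X y + (christoffel G y).flip (X y) : E →L[ℝ] E) : E →ₗ[ℝ] E)

/-- The Laplacian, that is, the divergence of the gradient. -/
def laplacianLocal (G : E → E →L[ℝ] E →L[ℝ] ℝ) (u : E → ℝ) (y : E) : ℝ :=
  LinearMap.trace ℝ E (covariantDeriv G (gradientLocal G u) y)

theorem covariantDeriv_apply (G : E → E →L[ℝ] E →L[ℝ] ℝ) (X : E → E) (y v : E) :
    covariantDeriv G X y v = fderiv ℝ X y v + christoffel G y v (X y) := rfl

theorem christoffel_congr {G G' : E → E →L[ℝ] E →L[ℝ] ℝ} {y : E} (h : G =ᶠ[𝓝 y] G') :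
    christoffel G y = christoffel G' y := by
  unfold christoffel
  rw [h.fderiv_eq, h.eq_of_nhds]

theorem christoffel_eventuallyEq {G G' : E → E →L[ℝ] E →L[ℝ] ℝ} {y : E} (h : G =ᶠ[𝓝 y] G') :
    christoffel G =ᶠ[𝓝 y] christoffel G' :=
  h.eventuallyEq_nhds.mono fun _ hz => christoffel_congr hz

theorem ricci_congr {G G' : E → E →L[ℝ] E →L[ℝ] ℝ} {y : E} (h : G =ᶠ[𝓝 y] G') :
    ricci G y = ricci G' y := by
  ext v w
  change LinearMap.trace ℝ E _ = LinearMap.trace ℝ E _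
  congr 1
  ext u
  simp only [curvatureOperator, LinearMap.coe_mk, AddHom.coe_mk, christoffel_congr h,
    (christoffel_eventuallyEq h).fderiv_eq]

theorem scalarCurvatureLocal_congr [FiniteDimensional ℝ E] {G G' : E → E →L[ℝ] E →L[ℝ] ℝ} {y : E}
    (h : G =ᶠ[𝓝 y] G') : scalarCurvatureLocal G y = scalarCurvatureLocal G' y := by
  unfold scalarCurvatureLocal
  rw [ricci_congr h, h.eq_of_nhds]

variable [FiniteDimensional ℝ E]

section Bilin
variable {B : E →L[ℝ] E →L[ℝ] ℝ}

theorem exists_equiv_of_definite (hB : ∀ v, v ≠ 0 → B v v ≠ 0) :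
    ∃ e : E ≃L[ℝ] (E →L[ℝ] ℝ), B = (e : E →L[ℝ] (E →L[ℝ] ℝ)) := by
  have hinj : Function.Injective (B : E →ₗ[ℝ] (E →L[ℝ] ℝ)) := by
    refine (injective_iff_map_eq_zero _).2 fun a ha => ?_
    by_contra h
    exact hB a h (by simpa using congrArg (fun l : E →L[ℝ] ℝ => l a) ha)
  have hfin : finrank ℝ E = finrank ℝ (E →L[ℝ] ℝ) := by
    rw [← (LinearMap.toContinuousLinearMap (𝕜 := ℝ) (E := E) (F' := ℝ)).finrank_eq,
      ← Subspace.dual_finrank_eq (K := ℝ) (V := E)]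
  exact ⟨(LinearEquiv.ofInjectiveOfFinrankEq (B : E →ₗ[ℝ] (E →L[ℝ] ℝ)) hinj
    hfin).toContinuousLinearEquiv, by ext a b; rfl⟩

theorem apply_inverse_of_definite (hB : ∀ v, v ≠ 0 → B v v ≠ 0) (l : E →L[ℝ] ℝ) :
    B (B.inverse l) = l := by
  obtain ⟨e, rfl⟩ := exists_equiv_of_definite hB
  simp [ContinuousLinearMap.inverse_equiv]

theorem inverse_apply_of_definite (hB : ∀ v, v ≠ 0 → B v v ≠ 0) (v : E) :
    B.inverse (B v) = v := by
  obtain ⟨e, rfl⟩ := exists_equiv_of_definite hB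
  simp [ContinuousLinearMap.inverse_equiv]

theorem eq_of_forall_apply_eq (hB : ∀ v, v ≠ 0 → B v v ≠ 0) {a b : E}
    (h : ∀ z, B a z = B b z) : a = b := by
  rw [← inverse_apply_of_definite hB a, ← inverse_apply_of_definite hB b]
  congr 1
  ext z
  exact h z

end Bilin

theorem gradientLocal_spec {G : E → E →L[ℝ] E →L[ℝ] ℝ} {z : E} (hG : ∀ v, v ≠ 0 → G z v v ≠ 0)
    (u : E → ℝ) (v : E) : G z (gradientLocal G u z) v = fderiv ℝ u z v := by
  rw [gradientLocal, apply_inverse_of_definite hG]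

namespace IsMetricAt

variable {G : E → E →L[ℝ] E →L[ℝ] ℝ} {y : E}

omit [FiniteDimensional ℝ E] in
theorem contDiffAt (h : IsMetricAt G y) : ContDiffAt ℝ ∞ G y := h.contDiff.self_of_nhds

omit [FiniteDimensional ℝ E] in
theorem definite (h : IsMetricAt G y) : ∀ v, v ≠ 0 → G y v v ≠ 0 := fun v hv =>
  (h.pos.self_of_nhds v hv).ne'

omit [FiniteDimensional ℝ E] in
theorem congr {G' : E → E →L[ℝ] E →L[ℝ] ℝ} (h : IsMetricAt G y) (h' : G' =ᶠ[𝓝 y] G) :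
    IsMetricAt G' y where
  contDiff := by
    filter_upwards [h.contDiff, h'.eventually_nhds] with z h1 h2 using h1.congr_of_eventuallyEq h2
  symm := by filter_upwards [h.symm, h'] with z h1 h2; rwa [h2]
  pos := by filter_upwards [h.pos, h'] with z h1 h2; rwa [h2]

omit [FiniteDimensional ℝ E] in
theorem eventually (h : IsMetricAt G y) : ∀ᶠ z in 𝓝 y, IsMetricAt G z := by
  filter_upwards [h.contDiff.eventually_nhds, h.symm.eventually_nhds,
    h.pos.eventually_nhds] with z h1 h2 h3 using ⟨h1, h2, h3⟩

theorem contDiffAt_inverse (h : IsMetricAt G y) : ContDiffAt ℝ ∞ (fun z => (G z).inverse) y := by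
  obtain ⟨e, he⟩ := exists_equiv_of_definite h.definite
  have := contDiffAt_map_inverse (𝕜 := ℝ) (n := ∞) e
  rw [← he] at this
  exact ContDiffAt.comp y this h.contDiffAt

theorem contDiffAt_christoffel (h : IsMetricAt G y) : ContDiffAt ℝ ∞ (christoffel G) y := by
  unfold christoffel
  have hD : ContDiffAt ℝ ∞ (fderiv ℝ G) y := h.contDiffAt.fderiv_right (by simp)
  have hF : ContDiffAt ℝ ∞ (fun z => (fderiv ℝ G z).flip) y :=
    (ContinuousLinearMap.flipₗᵢ ℝ E E (E →L[ℝ] ℝ)).contDiff.contDiffAt.comp y hD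
  refine ContDiffAt.clm_comp ?_ ?_
  · exact (ContinuousLinearMap.compL ℝ E (E →L[ℝ] ℝ) E).contDiff.contDiffAt.comp y
      h.contDiffAt_inverse
  · exact (contDiffAt_const (c := (1 / 2 : ℝ))).smul ((hD.add hF).sub (contDiffAt_const.clm_comp hF))

theorem contDiffAt_gradientLocal (h : IsMetricAt G y) {u : E → ℝ} (hu : ContDiffAt ℝ ∞ u y) :
    ContDiffAt ℝ ∞ (gradientLocal G u) y :=
  h.contDiffAt_inverse.clm_apply (hu.fderiv_right (by simp))

omit [FiniteDimensional ℝ E] in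
theorem fderiv_symm (h : IsMetricAt G y) (u v w : E) :
    fderiv ℝ G y u v w = fderiv ℝ G y u w v := by
  have hd : DifferentiableAt ℝ G y := h.contDiffAt.differentiableAt (by simp)
  have key : ∀ a b, HasFDerivAt (fun z => G z a b) (((fderiv ℝ G y).flip a).flip b) y :=
    fun a b => by
      have := (hd.hasFDerivAt.clm_apply (hasFDerivAt_const a y)).clm_apply (hasFDerivAt_const b y)
      refine this.congr_fderiv ?_
      ext x; simp
  have h1 := key v w
  have h2 := (key w v).congr_of_eventuallyEq (h.symm.mono fun z hz => hz v w)
  simpa using congrArg (fun l : E →L[ℝ] ℝ => l u) (h1.unique h2)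

theorem christoffel_symm (h : IsMetricAt G y) (v w : E) :
    christoffel G y v w = christoffel G y w v := by
  refine eq_of_forall_apply_eq h.definite fun z => ?_
  rw [christoffel_apply G y h.definite, christoffel_apply G y h.definite, h.fderiv_symm z v w]
  ring

/-- The Levi-Civita connection is compatible with the metric. -/
theorem fderiv_eq (h : IsMetricAt G y) (u v w : E) :
    fderiv ℝ G y u v w = G y (christoffel G y u v) w + G y v (christoffel G y u w) := by
  rw [h.symm.self_of_nhds v, christoffel_apply G y h.definite, christoffel_apply G y h.definite,
    h.fderiv_symm u w v, h.fderiv_symm w u v, h.fderiv_symm v u w]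
  ring

end IsMetricAt

omit [FiniteDimensional ℝ E] in
theorem fderiv_clm_apply₂ {F F' F'' : Type*} [NormedAddCommGroup F] [NormedSpace ℝ F]
    [NormedAddCommGroup F'] [NormedSpace ℝ F'] [NormedAddCommGroup F''] [NormedSpace ℝ F'']
    {C : E → F →L[ℝ] F' →L[ℝ] F''} {y : E} (hC : DifferentiableAt ℝ C y) (u : E) (v : F) (w : F') :
    fderiv ℝ C y u v w = fderiv ℝ (fun z => C z v w) y u := by
  have := (hC.hasFDerivAt.clm_apply (hasFDerivAt_const v y)).clm_apply (hasFDerivAt_const w y)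
  rw [this.fderiv]
  simp

end LocalCurvature

section Conformal

variable {E : Type*} [NormedAddCommGroup E] [NormedSpace ℝ E] [FiniteDimensional ℝ E]
  {G : E → E →L[ℝ] E →L[ℝ] ℝ} {σ : E → ℝ} {y : E}

omit [FiniteDimensional ℝ E] in
theorem IsMetricAt.exp_smul (hG : IsMetricAt G y) (hσ : ∀ᶠ z in 𝓝 y, ContDiffAt ℝ ∞ σ z) :
    IsMetricAt (fun z => Real.exp (2 * σ z) • G z) y where
  contDiff := by
    filter_upwards [hG.contDiff, hσ] with z h1 h2
    exact (Real.contDiff_exp.contDiffAt.comp z (contDiffAt_const.mul h2)).smul h1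
  symm := by
    filter_upwards [hG.symm] with z h1 v w
    simp [h1 v w]
  pos := by
    filter_upwards [hG.pos] with z h1 v hv
    simpa using mul_pos (Real.exp_pos _) (h1 v hv)

theorem christoffel_exp_smul (hG : IsMetricAt G y) (hσ : ContDiffAt ℝ ∞ σ y) (v w : E) :
    christoffel (fun z => Real.exp (2 * σ z) • G z) y v w =
      christoffel G y v w + fderiv ℝ σ y v • w + fderiv ℝ σ y w • v
        - G y v w • gradientLocal G σ y := by
  have hsd : HasFDerivAt σ (fderiv ℝ σ y) y := (hσ.differentiableAt (by simp)).hasFDerivAt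
  have hGd : HasFDerivAt G (fderiv ℝ G y) y := (hG.contDiffAt.differentiableAt (by simp)).hasFDerivAt
  have hpos : ∀ a, a ≠ 0 → (Real.exp (2 * σ y) • G y) a a ≠ 0 := fun a ha => by
    simpa using hG.definite a ha
  have hD := ((hsd.const_mul 2).exp.smul hGd).fderiv
  have hD' : ∀ a b c, fderiv ℝ (fun z => Real.exp (2 * σ z) • G z) y a b c =
      Real.exp (2 * σ y) * (fderiv ℝ G y a b c + 2 * fderiv ℝ σ y a * G y b c) := fun a b c => by
    erw [hD]
    simp
    ring
  refine eq_of_forall_apply_eq hpos fun z => ?_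
  have h1 := christoffel_apply (fun z => Real.exp (2 * σ z) • G z) y hpos v w z
  simp only [hD'] at h1
  erw [h1]
  have h2 := christoffel_apply G y hG.definite v w z
  have h3 := gradientLocal_spec hG.definite σ z
  have h4 := hG.symm.self_of_nhds w v
  simp only [map_add, map_sub, map_smul, add_apply,
    sub_apply, smul_apply, h2, h3, smul_eq_mul]
  ring

/-- The Hessian of `σ` in terms of the covariant derivative of its gradient. -/
theorem fderiv_fderiv_apply_eq (hG : IsMetricAt G y) (hσ : ∀ᶠ z in 𝓝 y, ContDiffAt ℝ ∞ σ z)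
    (u w : E) :
    fderiv ℝ (fderiv ℝ σ) y u w = G y (covariantDeriv G (gradientLocal G σ) y u) w
      + fderiv ℝ σ y (christoffel G y u w) := by
  have hσ' := hσ.self_of_nhds
  have hX := ((hG.contDiffAt_gradientLocal hσ').differentiableAt (by simp)).hasFDerivAt
  have hGd := (hG.contDiffAt.differentiableAt (by simp)).hasFDerivAt
  have hS : HasFDerivAt (fderiv ℝ σ) (fderiv ℝ (fderiv ℝ σ) y) y :=
    ((hσ'.fderiv_right (m := ∞) (by simp)).differentiableAt (by simp)).hasFDerivAt
  have h1 := (hGd.clm_apply hX).clm_apply (hasFDerivAt_const w y)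
  have h2 := hS.clm_apply (hasFDerivAt_const w y)
  have h3 : (fun z => G z (gradientLocal G σ z) w) =ᶠ[𝓝 y] fun z => fderiv ℝ σ z w := by
    filter_upwards [hG.eventually] with z hz using gradientLocal_spec hz.definite σ w
  have h4 := congrArg (fun l : E →L[ℝ] ℝ => l u) (h1.unique (h2.congr_of_eventuallyEq h3))
  simp [hG.fderiv_eq, gradientLocal_spec hG.definite] at h4
  rw [covariantDeriv_apply, map_add, add_apply, ← h4]
  ring

theorem curvatureOperator_exp_smul (hG : IsMetricAt G y)
    (hσ : ∀ᶠ z in 𝓝 y, ContDiffAt ℝ ∞ σ z) (v w : E) :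
    curvatureOperator (fun z => Real.exp (2 * σ z) • G z) y v w =
      curvatureOperator G y v w
      + ((G y w : E →ₗ[ℝ] ℝ) ∘ₗ covariantDeriv G (gradientLocal G σ) y
          - fderiv ℝ σ y w • (fderiv ℝ σ y : E →ₗ[ℝ] ℝ)).smulRight v
      - (G y (covariantDeriv G (gradientLocal G σ) y v) w - fderiv ℝ σ y v * fderiv ℝ σ y w
          + G y v w * fderiv ℝ σ y (gradientLocal G σ y)) • LinearMap.id
      - G y v w • covariantDeriv G (gradientLocal G σ) y
      + (G y w : E →ₗ[ℝ] ℝ).smulRight (covariantDeriv G (gradientLocal G σ) y v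
          + fderiv ℝ σ y (gradientLocal G σ y) • v - fderiv ℝ σ y v • gradientLocal G σ y)
      + (fderiv ℝ σ y : E →ₗ[ℝ] ℝ).smulRight (G y v w • gradientLocal G σ y) := by
  have hσ' := hσ.self_of_nhds
  have hX := ((hG.contDiffAt_gradientLocal hσ').differentiableAt (by simp)).hasFDerivAt
  have hGd := (hG.contDiffAt.differentiableAt (by simp)).hasFDerivAt
  have hΓ := hG.contDiffAt_christoffel.differentiableAt (by simp)
  have hS : HasFDerivAt (fderiv ℝ σ) (fderiv ℝ (fderiv ℝ σ) y) y :=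
    ((hσ'.fderiv_right (m := ∞) (by simp)).differentiableAt (by simp)).hasFDerivAt
  have hD : ∀ a b c, fderiv ℝ (christoffel (fun z => Real.exp (2 * σ z) • G z)) y a b c =
      fderiv ℝ (christoffel G) y a b c + fderiv ℝ (fderiv ℝ σ) y a b • c
        + fderiv ℝ (fderiv ℝ σ) y a c • b
        - (fderiv ℝ G y a b c • gradientLocal G σ y
          + G y b c • fderiv ℝ (gradientLocal G σ) y a) := by
    intro a b c
    have h1 := ((hG.exp_smul hσ).contDiffAt_christoffel).differentiableAt (by simp)
    rw [fderiv_clm_apply₂ h1]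
    have h2 : (fun z => christoffel (fun z => Real.exp (2 * σ z) • G z) z b c) =ᶠ[𝓝 y]
        fun z => christoffel G z b c + fderiv ℝ σ z b • c + fderiv ℝ σ z c • b
        - G z b c • gradientLocal G σ z := by
      filter_upwards [hG.eventually, hσ] with z hz hz' using christoffel_exp_smul hz hz' b c
    have hΓ' := (hΓ.hasFDerivAt.clm_apply (hasFDerivAt_const b y)).clm_apply (hasFDerivAt_const c y)
    have hS' := fun b : E => hS.clm_apply (hasFDerivAt_const b y)
    have hG' := (hGd.clm_apply (hasFDerivAt_const b y)).clm_apply (hasFDerivAt_const c y)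
    have h3 := ((hΓ'.add ((hS' b).smul_const c)).add ((hS' c).smul_const b)).sub (hG'.smul hX)
    rw [h2.fderiv_eq]
    erw [h3.fderiv]
    simp
    abel
  have hsymm := hG.symm.self_of_nhds
  have hH : ∀ a b, fderiv ℝ (fderiv ℝ σ) y a b = fderiv ℝ (fderiv ℝ σ) y b a :=
    fun a b => (hσ'.isSymmSndFDerivAt (by
      rw [minSmoothness_of_isRCLikeNormedField]; exact WithTop.coe_le_coe.2 le_top)).eq a b
  ext u
  have e1 := hH v u
  have e2 := fderiv_fderiv_apply_eq hG hσ u w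
  have e3 := fderiv_fderiv_apply_eq hG hσ v w
  have e4 := hG.christoffel_symm v u
  have e5 := fun a : E => (hsymm a (gradientLocal G σ y)).trans (gradientLocal_spec hG.definite σ a)
  have e6 := hsymm w u
  have e7 := hsymm v u
  have e8 := hsymm w (fderiv ℝ (gradientLocal G σ) y u)
  have e9 := hsymm w (christoffel G y u (gradientLocal G σ y))
  simp only [curvatureOperator, LinearMap.coe_mk, AddHom.coe_mk, hD, hG.fderiv_eq,
    christoffel_exp_smul hG hσ', e1, e2, e3, map_add, map_sub, map_smul, e4, e5, e6, e7, e8, e9,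
    LinearMap.add_apply, LinearMap.sub_apply, LinearMap.smul_apply, LinearMap.smulRight_apply,
    LinearMap.comp_apply, ContinuousLinearMap.coe_coe, LinearMap.id_apply, covariantDeriv_apply,
    add_apply, smul_eq_mul]
  module

theorem ricci_exp_smul (hG : IsMetricAt G y) (hσ : ∀ᶠ z in 𝓝 y, ContDiffAt ℝ ∞ σ z) (v w : E) :
    ricci (fun z => Real.exp (2 * σ z) • G z) y v w = ricci G y v w
      - ((finrank ℝ E : ℝ) - 2) * (G y (covariantDeriv G (gradientLocal G σ) y v) w
          - fderiv ℝ σ y v * fderiv ℝ σ y w)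
      - (laplacianLocal G σ y
          + ((finrank ℝ E : ℝ) - 2) * fderiv ℝ σ y (gradientLocal G σ y)) * G y v w := by
  change LinearMap.trace ℝ E _ = LinearMap.trace ℝ E _ - _ - _
  rw [curvatureOperator_exp_smul hG hσ]
  have hsymm := hG.symm.self_of_nhds
  have h1 := hsymm w (covariantDeriv G (gradientLocal G σ) y v)
  have h2 : G y w (gradientLocal G σ y) = fderiv ℝ σ y w :=
    (hsymm w (gradientLocal G σ y)).trans (gradientLocal_spec hG.definite σ w)
  have h3 := hsymm w v
  simp only [map_add, map_sub, map_smul, LinearMap.trace_smulRight, LinearMap.trace_id,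
    LinearMap.sub_apply, LinearMap.smul_apply, LinearMap.comp_apply, ContinuousLinearMap.coe_coe,
    smul_eq_mul, laplacianLocal, h1, h2, h3]
  ring

/-- The scalar curvature of a metric `e^{2σ} G`. -/
theorem scalarCurvatureLocal_exp_smul (hG : IsMetricAt G y)
    (hσ : ∀ᶠ z in 𝓝 y, ContDiffAt ℝ ∞ σ z) :
    scalarCurvatureLocal (fun z => Real.exp (2 * σ z) • G z) y =
      (Real.exp (2 * σ y))⁻¹ * (scalarCurvatureLocal G y
        - 2 * ((finrank ℝ E : ℝ) - 1) * laplacianLocal G σ y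
        - ((finrank ℝ E : ℝ) - 1) * ((finrank ℝ E : ℝ) - 2)
          * fderiv ℝ σ y (gradientLocal G σ y)) := by
  have hinv : ∀ l : E →L[ℝ] ℝ, (Real.exp (2 * σ y) • G y).inverse l =
      (Real.exp (2 * σ y))⁻¹ • (G y).inverse l := by
    intro l
    refine eq_of_forall_apply_eq (hG.exp_smul hσ).definite fun z => ?_
    rw [apply_inverse_of_definite (hG.exp_smul hσ).definite]
    simp [apply_inverse_of_definite hG.definite]
  have key : (((Real.exp (2 * σ y) • G y).inverse : (E →L[ℝ] ℝ) →ₗ[ℝ] E) ∘ₗ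
      (LinearMap.toContinuousLinearMap : (E →ₗ[ℝ] ℝ) ≃ₗ[ℝ] (E →L[ℝ] ℝ)).toLinearMap ∘ₗ
        ricci (fun z => Real.exp (2 * σ z) • G z) y) =
      (Real.exp (2 * σ y))⁻¹ • ((((G y).inverse : (E →L[ℝ] ℝ) →ₗ[ℝ] E) ∘ₗ
      (LinearMap.toContinuousLinearMap : (E →ₗ[ℝ] ℝ) ≃ₗ[ℝ] (E →L[ℝ] ℝ)).toLinearMap ∘ₗ ricci G y)
      - ((finrank ℝ E : ℝ) - 2) • (covariantDeriv G (gradientLocal G σ) y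
          - (fderiv ℝ σ y : E →ₗ[ℝ] ℝ).smulRight (gradientLocal G σ y))
      - (laplacianLocal G σ y
          + ((finrank ℝ E : ℝ) - 2) * fderiv ℝ σ y (gradientLocal G σ y)) • LinearMap.id) := by
    ext v
    refine eq_of_forall_apply_eq hG.definite fun z => ?_
    simp only [LinearMap.comp_apply, ContinuousLinearMap.coe_coe, hinv, map_smul, smul_apply,
      apply_inverse_of_definite hG.definite, LinearMap.smul_apply, LinearMap.sub_apply, map_sub,
      sub_apply, LinearMap.smulRight_apply, LinearMap.id_apply, LinearEquiv.coe_coe,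
      LinearMap.coe_toContinuousLinearMap', ricci_exp_smul hG hσ, smul_eq_mul,
      gradientLocal_spec hG.definite]
  unfold scalarCurvatureLocal
  rw [key]
  simp only [map_smul, map_sub, LinearMap.trace_smulRight, LinearMap.trace_id, smul_eq_mul,
    ContinuousLinearMap.coe_coe]
  rw [show LinearMap.trace ℝ E (covariantDeriv G (gradientLocal G σ) y) = laplacianLocal G σ y
    from rfl]
  ring

theorem laplacianLocal_log (hG : IsMetricAt G y) {u : E → ℝ} (c : ℝ)
    (hu : ∀ᶠ z in 𝓝 y, ContDiffAt ℝ ∞ u z) (hpos : 0 < u y) :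
    laplacianLocal G (fun z => c * Real.log (u z)) y = c * (laplacianLocal G u y / u y
      - fderiv ℝ u y (gradientLocal G u y) / u y ^ 2) := by
  have hu' := hu.self_of_nhds
  have hd : HasFDerivAt u (fderiv ℝ u y) y := (hu'.differentiableAt (by simp)).hasFDerivAt
  have hX := ((hG.contDiffAt_gradientLocal hu').differentiableAt (by simp)).hasFDerivAt
  have h1 : gradientLocal G (fun z => c * Real.log (u z)) =ᶠ[𝓝 y]
      fun z => (c * (u z)⁻¹) • gradientLocal G u z := by
    filter_upwards [hu, hu'.continuousAt.eventually (lt_mem_nhds hpos)] with z h1 h2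
    have := (((h1.differentiableAt (by simp)).hasFDerivAt.log h2.ne').const_mul c).fderiv
    unfold gradientLocal
    erw [this]
    simp [smul_smul]
  have h2 := (((hasDerivAt_inv hpos.ne').comp_hasFDerivAt y hd).const_mul c).smul hX
  have key : covariantDeriv G (gradientLocal G (fun z => c * Real.log (u z))) y =
      (c * (u y)⁻¹) • covariantDeriv G (gradientLocal G u) y
        - (fderiv ℝ u y : E →ₗ[ℝ] ℝ).smulRight ((c / u y ^ 2) • gradientLocal G u y) := by
    ext v
    rw [covariantDeriv_apply, h1.fderiv_eq, h1.self_of_nhds]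
    erw [h2.fderiv]
    simp [covariantDeriv_apply]
    module
  rw [laplacianLocal, key]
  simp [laplacianLocal]
  field_simp

/-- The scalar curvature of a metric `u^{4/(n-2)} G`. -/
theorem scalarCurvatureLocal_rpow_smul (hG : IsMetricAt G y) {u : E → ℝ}
    (hu : ∀ᶠ z in 𝓝 y, ContDiffAt ℝ ∞ u z) (hpos : 0 < u y) (hn : 2 < finrank ℝ E) :
    scalarCurvatureLocal (fun z => u z ^ (4 / ((finrank ℝ E : ℝ) - 2)) • G z) y =
      (u y ^ (4 / ((finrank ℝ E : ℝ) - 2)))⁻¹ * (scalarCurvatureLocal G y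
        - 4 * ((finrank ℝ E : ℝ) - 1) / ((finrank ℝ E : ℝ) - 2) * (laplacianLocal G u y / u y)) := by
  have hn' : (0 : ℝ) < (finrank ℝ E : ℝ) - 2 := by
    have : (2 : ℝ) < finrank ℝ E := by exact_mod_cast hn
    linarith
  set n : ℝ := (finrank ℝ E : ℝ) with hn_def
  have hu' := hu.self_of_nhds
  have hpos' := hu'.continuousAt.eventually (lt_mem_nhds hpos)
  have hexp : ∀ z, 0 < u z →
      Real.exp (2 * ((2 / (n - 2)) * Real.log (u z))) = u z ^ (4 / (n - 2)) := fun z hz => by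
    rw [Real.rpow_def_of_pos hz]
    congr 1
    ring
  have h1 : (fun z => u z ^ (4 / (n - 2)) • G z) =ᶠ[𝓝 y]
      fun z => Real.exp (2 * ((2 / (n - 2)) * Real.log (u z))) • G z := by
    filter_upwards [hpos'] with z hz
    rw [hexp z hz]
  have hσ : ∀ᶠ z in 𝓝 y, ContDiffAt ℝ ∞ (fun z => (2 / (n - 2)) * Real.log (u z)) z := by
    filter_upwards [hu, hpos'] with z hz hz'
    exact contDiffAt_const.mul (hz.log hz'.ne')
  have hd : HasFDerivAt u (fderiv ℝ u y) y := (hu'.differentiableAt (by simp)).hasFDerivAt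
  have h2 := ((hd.log hpos.ne').const_mul (2 / (n - 2))).fderiv
  have h3 : gradientLocal G (fun z => (2 / (n - 2)) * Real.log (u z)) y =
      ((2 / (n - 2)) * (u y)⁻¹) • gradientLocal G u y := by
    unfold gradientLocal
    erw [h2]
    simp [smul_smul]
  rw [scalarCurvatureLocal_congr h1, scalarCurvatureLocal_exp_smul hG hσ, hexp y hpos,
    laplacianLocal_log hG _ hu hpos, h3]
  erw [h2]
  simp only [smul_apply, map_smul, smul_eq_mul]
  rw [← hn_def]
  congr 1
  field_simp
  ring

end Conformal

section Product

variable {E₁ : Type*} [NormedAddCommGroup E₁] [NormedSpace ℝ E₁]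
  {E₂ : Type*} [NormedAddCommGroup E₂] [NormedSpace ℝ E₂]
  {G₁ : E₁ → E₁ →L[ℝ] E₁ →L[ℝ] ℝ} {G₂ : E₂ → E₂ →L[ℝ] E₂ →L[ℝ] ℝ} {z : E₁ × E₂}

/-- The product of two fields of bilinear forms. -/
def productField (G₁ : E₁ → E₁ →L[ℝ] E₁ →L[ℝ] ℝ) (G₂ : E₂ → E₂ →L[ℝ] E₂ →L[ℝ] ℝ) (z : E₁ × E₂) :
    (E₁ × E₂) →L[ℝ] (E₁ × E₂) →L[ℝ] ℝ :=
  (G₁ z.1).bilinearComp (.fst ℝ E₁ E₂) (.fst ℝ E₁ E₂)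
    + (G₂ z.2).bilinearComp (.snd ℝ E₁ E₂) (.snd ℝ E₁ E₂)

@[simp] theorem productField_apply (z v w : E₁ × E₂) :
    productField G₁ G₂ z v w = G₁ z.1 v.1 w.1 + G₂ z.2 v.2 w.2 := rfl

theorem ContDiffAt.bilinearComp {E F F' : Type*} [NormedAddCommGroup E] [NormedSpace ℝ E]
    [NormedAddCommGroup F] [NormedSpace ℝ F] [NormedAddCommGroup F'] [NormedSpace ℝ F']
    {n : WithTop ℕ∞} {B : E → F →L[ℝ] F →L[ℝ] ℝ} {L : E → F' →L[ℝ] F} {y : E}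
    (hB : ContDiffAt ℝ n B y) (hL : ContDiffAt ℝ n L y) :
    ContDiffAt ℝ n (fun x => (B x).bilinearComp (L x) (L x)) y := by
  have h1 := (ContinuousLinearMap.compL ℝ F' F ℝ).flip.contDiff.contDiffAt.comp y hL (n := n)
  exact h1.clm_comp (hB.clm_comp hL)

theorem IsMetricAt.productField (h₁ : IsMetricAt G₁ z.1) (h₂ : IsMetricAt G₂ z.2) :
    IsMetricAt (productField G₁ G₂) z where
  contDiff := by
    filter_upwards [continuousAt_fst.eventually h₁.contDiff,
      continuousAt_snd.eventually h₂.contDiff] with x hx hx'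
    exact (ContDiffAt.bilinearComp (hx.comp x contDiffAt_fst) contDiffAt_const).add
      (ContDiffAt.bilinearComp (hx'.comp x contDiffAt_snd) contDiffAt_const)
  symm := by
    filter_upwards [continuousAt_fst.eventually h₁.symm,
      continuousAt_snd.eventually h₂.symm] with x hx hx' v w
    simp [hx v.1, hx' v.2]
  pos := by
    filter_upwards [continuousAt_fst.eventually h₁.pos,
      continuousAt_snd.eventually h₂.pos] with x hx hx' v hv
    rw [productField_apply]
    have h1 : 0 ≤ G₁ x.1 v.1 v.1 := by
      rcases eq_or_ne v.1 0 with h | h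
      · simp [h]
      · exact (hx _ h).le
    have h2 : 0 ≤ G₂ x.2 v.2 v.2 := by
      rcases eq_or_ne v.2 0 with h | h
      · simp [h]
      · exact (hx' _ h).le
    by_cases h : v.1 = 0
    · have : v.2 ≠ 0 := fun h' => hv (Prod.ext h h')
      have := hx' _ this
      linarith
    · have := hx _ h
      linarith

variable [FiniteDimensional ℝ E₁] [FiniteDimensional ℝ E₂]

omit [FiniteDimensional ℝ E₁] [FiniteDimensional ℝ E₂] in
theorem eventually_isMetricAt_prod (h₁ : IsMetricAt G₁ z.1) (h₂ : IsMetricAt G₂ z.2) :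
    ∀ᶠ x : E₁ × E₂ in 𝓝 z, IsMetricAt G₁ x.1 ∧ IsMetricAt G₂ x.2 :=
  (continuousAt_fst.eventually h₁.eventually).and (continuousAt_snd.eventually h₂.eventually)

omit [FiniteDimensional ℝ E₁] [FiniteDimensional ℝ E₂] in
theorem fderiv_productField (h₁ : IsMetricAt G₁ z.1) (h₂ : IsMetricAt G₂ z.2) (u v w : E₁ × E₂) :
    fderiv ℝ (productField G₁ G₂) z u v w =
      fderiv ℝ G₁ z.1 u.1 v.1 w.1 + fderiv ℝ G₂ z.2 u.2 v.2 w.2 := by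
  have hd₁ := h₁.contDiffAt.differentiableAt (by simp)
  have hd₂ := h₂.contDiffAt.differentiableAt (by simp)
  rw [fderiv_clm_apply₂ ((h₁.productField h₂).contDiffAt.differentiableAt (by simp))]
  simp only [productField_apply]
  have k₁ := ((hd₁.hasFDerivAt.clm_apply (hasFDerivAt_const v.1 z.1)).clm_apply
    (hasFDerivAt_const w.1 z.1)).comp z hasFDerivAt_fst
  have k₂ := ((hd₂.hasFDerivAt.clm_apply (hasFDerivAt_const v.2 z.2)).clm_apply
    (hasFDerivAt_const w.2 z.2)).comp z hasFDerivAt_snd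
  have := (k₁.add k₂).fderiv
  erw [this]
  simp

theorem christoffel_productField (h₁ : IsMetricAt G₁ z.1) (h₂ : IsMetricAt G₂ z.2)
    (v w : E₁ × E₂) :
    christoffel (productField G₁ G₂) z v w =
      (christoffel G₁ z.1 v.1 w.1, christoffel G₂ z.2 v.2 w.2) := by
  have h := h₁.productField h₂
  refine eq_of_forall_apply_eq h.definite fun x => ?_
  rw [christoffel_apply _ _ h.definite, productField_apply, christoffel_apply _ _ h₁.definite,
    christoffel_apply _ _ h₂.definite]
  simp only [fderiv_productField h₁ h₂]
  ring

theorem inverse_productField (h₁ : IsMetricAt G₁ z.1) (h₂ : IsMetricAt G₂ z.2)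
    (l : (E₁ × E₂) →L[ℝ] ℝ) :
    (productField G₁ G₂ z).inverse l =
      ((G₁ z.1).inverse (l.comp (.inl ℝ E₁ E₂)), (G₂ z.2).inverse (l.comp (.inr ℝ E₁ E₂))) := by
  have h := h₁.productField h₂
  refine eq_of_forall_apply_eq h.definite fun x => ?_
  rw [apply_inverse_of_definite h.definite, productField_apply,
    apply_inverse_of_definite h₁.definite, apply_inverse_of_definite h₂.definite]
  simp [← map_add]

theorem curvatureOperator_productField (h₁ : IsMetricAt G₁ z.1) (h₂ : IsMetricAt G₂ z.2)
    (v w : E₁ × E₂) :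
    curvatureOperator (productField G₁ G₂) z v w =
      (curvatureOperator G₁ z.1 v.1 w.1).prodMap (curvatureOperator G₂ z.2 v.2 w.2) := by
  have hd := (h₁.productField h₂).contDiffAt_christoffel.differentiableAt (by simp)
  have hd₁ := h₁.contDiffAt_christoffel.differentiableAt (by simp)
  have hd₂ := h₂.contDiffAt_christoffel.differentiableAt (by simp)
  have hD : ∀ a b c, fderiv ℝ (christoffel (productField G₁ G₂)) z a b c =
      (fderiv ℝ (christoffel G₁) z.1 a.1 b.1 c.1, fderiv ℝ (christoffel G₂) z.2 a.2 b.2 c.2) := by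
    intro a b c
    have k₁ := ((hd₁.hasFDerivAt.clm_apply (hasFDerivAt_const b.1 z.1)).clm_apply
      (hasFDerivAt_const c.1 z.1)).comp z hasFDerivAt_fst
    have k₂ := ((hd₂.hasFDerivAt.clm_apply (hasFDerivAt_const b.2 z.2)).clm_apply
      (hasFDerivAt_const c.2 z.2)).comp z hasFDerivAt_snd
    have he : (fun x => christoffel (productField G₁ G₂) x b c) =ᶠ[𝓝 z]
        fun x => (christoffel G₁ x.1 b.1 c.1, christoffel G₂ x.2 b.2 c.2) := by
      filter_upwards [eventually_isMetricAt_prod h₁ h₂] with x hx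
        using christoffel_productField hx.1 hx.2 b c
    rw [fderiv_clm_apply₂ hd, he.fderiv_eq]
    have := (k₁.prodMk k₂).fderiv
    erw [this]
    simp
  refine LinearMap.ext fun u => ?_
  simp only [curvatureOperator, LinearMap.coe_mk, AddHom.coe_mk, hD,
    christoffel_productField h₁ h₂, LinearMap.prodMap_apply, Prod.mk_add_mk, Prod.mk_sub_mk]

theorem ricci_productField (h₁ : IsMetricAt G₁ z.1) (h₂ : IsMetricAt G₂ z.2) (v w : E₁ × E₂) :
    ricci (productField G₁ G₂) z v w = ricci G₁ z.1 v.1 w.1 + ricci G₂ z.2 v.2 w.2 := by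
  change LinearMap.trace ℝ _ _ = LinearMap.trace ℝ _ _ + LinearMap.trace ℝ _ _
  rw [curvatureOperator_productField h₁ h₂, LinearMap.trace_prodMap']

/-- The scalar curvature of a Riemannian product. -/
theorem scalarCurvatureLocal_productField (h₁ : IsMetricAt G₁ z.1) (h₂ : IsMetricAt G₂ z.2) :
    scalarCurvatureLocal (productField G₁ G₂) z =
      scalarCurvatureLocal G₁ z.1 + scalarCurvatureLocal G₂ z.2 := by
  unfold scalarCurvatureLocal
  rw [← LinearMap.trace_prodMap']
  congr 1
  refine LinearMap.ext fun v => ?_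
  simp only [LinearMap.comp_apply, ContinuousLinearMap.coe_coe, LinearEquiv.coe_coe,
    inverse_productField h₁ h₂, LinearMap.prodMap_apply]
  congr 2 <;>
  · ext x
    simp [ricci_productField h₁ h₂]

theorem gradientLocal_comp_snd (h₁ : IsMetricAt G₁ z.1) (h₂ : IsMetricAt G₂ z.2) {u : E₂ → ℝ}
    (hu : DifferentiableAt ℝ u z.2) :
    gradientLocal (productField G₁ G₂) (fun x => u x.2) z = (0, gradientLocal G₂ u z.2) := by
  have := (hu.hasFDerivAt.comp z hasFDerivAt_snd).fderiv
  unfold gradientLocal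
  erw [this]
  rw [inverse_productField h₁ h₂]
  have e1 : (((fderiv ℝ u z.2).comp (.snd ℝ E₁ E₂)).comp (.inl ℝ E₁ E₂)) = 0 := by ext; simp
  have e2 : (((fderiv ℝ u z.2).comp (.snd ℝ E₁ E₂)).comp (.inr ℝ E₁ E₂)) = fderiv ℝ u z.2 := by
    ext; simp
  rw [e1, e2, map_zero]

theorem laplacianLocal_comp_snd (h₁ : IsMetricAt G₁ z.1) (h₂ : IsMetricAt G₂ z.2) {u : E₂ → ℝ}
    (hu : ∀ᶠ x in 𝓝 z.2, ContDiffAt ℝ ∞ u x) :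
    laplacianLocal (productField G₁ G₂) (fun x => u x.2) z = laplacianLocal G₂ u z.2 := by
  have he : gradientLocal (productField G₁ G₂) (fun x => u x.2) =ᶠ[𝓝 z]
      fun x => ((0 : E₁), gradientLocal G₂ u x.2) := by
    filter_upwards [eventually_isMetricAt_prod h₁ h₂, continuousAt_snd.eventually hu] with x hx hx'
      using gradientLocal_comp_snd hx.1 hx.2 (hx'.differentiableAt (by simp))
  have hX := (((h₂.contDiffAt_gradientLocal hu.self_of_nhds).differentiableAt
    (by simp)).hasFDerivAt).comp z hasFDerivAt_snd
  have hX' := ((hasFDerivAt_const (0 : E₁) z).prodMk hX).fderiv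
  have key : covariantDeriv (productField G₁ G₂)
      (gradientLocal (productField G₁ G₂) fun x => u x.2) z =
      LinearMap.prodMap 0 (covariantDeriv G₂ (gradientLocal G₂ u) z.2) := by
    refine LinearMap.ext fun v => ?_
    rw [covariantDeriv_apply, he.fderiv_eq, he.self_of_nhds, christoffel_productField h₁ h₂]
    erw [hX']
    simp [covariantDeriv_apply]
  rw [laplacianLocal, key, LinearMap.trace_prodMap', map_zero, zero_add, laplacianLocal]

end Product

section Round

variable {F : Type*} [NormedAddCommGroup F] [InnerProductSpace ℝ F]

/-- The inner product, as a bilinear form. -/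
def flatForm (F : Type*) [NormedAddCommGroup F] [InnerProductSpace ℝ F] : F →L[ℝ] F →L[ℝ] ℝ :=
  innerSL ℝ

@[simp] theorem flatForm_apply (v w : F) : flatForm F v w = inner ℝ v w := rfl

/-- The round metric in the coordinates of the stereographic projection. -/
def roundField (F : Type*) [NormedAddCommGroup F] [InnerProductSpace ℝ F] (z : F) :
    F →L[ℝ] F →L[ℝ] ℝ :=
  (16 / (‖z‖ ^ 2 + 4) ^ 2) • flatForm F

@[simp] theorem roundField_apply (z v w : F) :
    roundField F z v w = 16 / (‖z‖ ^ 2 + 4) ^ 2 * inner ℝ v w := by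
  simp [roundField]

theorem isMetricAt_flatForm (y : F) : IsMetricAt (fun _ => flatForm F) y where
  contDiff := .of_forall fun _ => contDiffAt_const
  symm := .of_forall fun _ v w => by simp [real_inner_comm]
  pos := .of_forall fun _ v hv => by
    rw [flatForm_apply, real_inner_self_eq_norm_sq]
    have : 0 < ‖v‖ := norm_pos_iff.2 hv
    positivity

theorem isMetricAt_roundField (y : F) : IsMetricAt (roundField F) y where
  contDiff := .of_forall fun x => by
    have hr : (‖x‖ ^ 2 + 4) ^ 2 ≠ 0 := by positivity
    have h : ContDiffAt ℝ ∞ (fun z : F => (‖z‖ ^ 2 + 4) ^ 2) x :=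
      (((contDiff_norm_sq ℝ).add contDiff_const).pow 2).contDiffAt
    exact (contDiffAt_const.div h hr).smul contDiffAt_const
  symm := .of_forall fun _ v w => by simp [real_inner_comm]
  pos := .of_forall fun _ v hv => by
    have : 0 < ‖v‖ := norm_pos_iff.2 hv
    rw [roundField_apply, real_inner_self_eq_norm_sq]
    positivity

variable [FiniteDimensional ℝ F]

omit [FiniteDimensional ℝ F] in
theorem christoffel_const (B : F →L[ℝ] F →L[ℝ] ℝ) : christoffel (fun _ => B) = 0 := by
  funext y
  unfold christoffel
  simp

theorem scalarCurvatureLocal_const (B : F →L[ℝ] F →L[ℝ] ℝ) (y : F) :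
    scalarCurvatureLocal (fun _ => B) y = 0 := by
  have : ricci (fun _ => B) y = 0 := by
    ext v w
    change LinearMap.trace ℝ F _ = 0
    have : curvatureOperator (fun _ => B) y v w = 0 := by
      ext u
      simp [curvatureOperator, christoffel_const]
    rw [this, map_zero]
  simp [scalarCurvatureLocal, this]

omit [FiniteDimensional ℝ F] in
theorem hasFDerivAt_norm_sq_add (z : F) (c : ℝ) :
    HasFDerivAt (fun x : F => ‖x‖ ^ 2 + c) (2 • flatForm F z) z :=
  (hasStrictFDerivAt_norm_sq z).hasFDerivAt.add_const c

/-- The scalar curvature of the unit sphere, at the centre of the stereographic projection. -/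
theorem scalarCurvatureLocal_roundField :
    scalarCurvatureLocal (roundField F) 0 = (finrank ℝ F : ℝ) * (finrank ℝ F - 1) := by
  set σ : F → ℝ := fun z => Real.log 4 - Real.log (‖z‖ ^ 2 + 4) with hσ_def
  have hr : ∀ z : F, 0 < ‖z‖ ^ 2 + 4 := fun z => by positivity
  have h0 : roundField F = fun z => Real.exp (2 * σ z) • flatForm F := by
    funext z
    rw [roundField, hσ_def]
    congr 1
    rw [mul_comm, Real.exp_mul, Real.exp_sub, Real.exp_log (hr z), Real.exp_log (by norm_num)]
    norm_num [div_pow]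
  have hσ : ∀ x, ContDiffAt ℝ ∞ σ x := fun x =>
    contDiffAt_const.sub (((contDiff_norm_sq ℝ).add contDiff_const).contDiffAt.log (hr x).ne')
  have hdσ : ∀ z, HasFDerivAt σ (-((‖z‖ ^ 2 + 4)⁻¹ • 2 • flatForm F z)) z := fun z =>
    ((hasFDerivAt_norm_sq_add z 4).log (hr z).ne').const_sub _
  have hgrad : gradientLocal (fun _ => flatForm F) σ =
      fun z => (-2 * (‖z‖ ^ 2 + 4)⁻¹) • z := by
    funext z
    refine eq_of_forall_apply_eq (isMetricAt_flatForm z).definite fun x => ?_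
    rw [gradientLocal_spec (G := fun _ => flatForm F) (isMetricAt_flatForm z).definite, (hdσ z).fderiv]
    simp
    ring
  have hX : HasFDerivAt (fun z : F => (-2 * (‖z‖ ^ 2 + 4)⁻¹) • z)
      ((-1 / 2 : ℝ) • ContinuousLinearMap.id ℝ F) 0 := by
    have := (((hasDerivAt_inv (hr 0).ne').comp_hasFDerivAt (0 : F)
      (hasFDerivAt_norm_sq_add 0 4)).const_mul (-2)).smul (hasFDerivAt_id (0 : F))
    refine this.congr_fderiv ?_
    ext v
    simp
    norm_num
  rw [h0, scalarCurvatureLocal_exp_smul (isMetricAt_flatForm 0) (.of_forall hσ),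
    scalarCurvatureLocal_const, hgrad]
  have hlap : laplacianLocal (fun _ => flatForm F) σ 0 =
      (-1 / 2) * finrank ℝ F := by
    have : covariantDeriv (fun _ => flatForm F)
        (gradientLocal (fun _ => flatForm F) σ) 0 =
        (-1 / 2 : ℝ) • LinearMap.id := by
      ext v
      rw [covariantDeriv_apply, hgrad, hX.fderiv, christoffel_const]
      simp
    rw [laplacianLocal, this, map_smul, LinearMap.trace_id, smul_eq_mul]
  rw [hlap]
  simp [hσ_def]
  ring

omit [FiniteDimensional ℝ F] in
theorem fderiv_roundField_zero : fderiv ℝ (roundField F) 0 = 0 := by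
  have h : (0 : ℝ) < (‖(0 : F)‖ ^ 2 + 4) ^ 2 := by positivity
  have h1 := (((hasDerivAt_inv h.ne').comp_hasFDerivAt (0 : F)
    ((hasFDerivAt_norm_sq_add 0 4).pow 2)).const_mul 16).smul_const
      (flatForm F)
  have h2 : roundField F = fun z => (16 * ((‖z‖ ^ 2 + 4) ^ 2)⁻¹) • flatForm F := by
    funext z
    rw [roundField, div_eq_mul_inv]
  rw [h2]
  refine (h1.congr_fderiv ?_).fderiv
  ext u v w
  simp

omit [FiniteDimensional ℝ F] in
theorem christoffel_roundField_zero : christoffel (roundField F) 0 = 0 := by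
  unfold christoffel
  rw [fderiv_roundField_zero]
  simp

/-- In stereographic coordinates, the restriction to the sphere of the linear form whose value at
the centre is `c` and whose gradient there is `b`. -/
def linearFormLocal (b : F) (c : ℝ) (z : F) : ℝ :=
  (4 * inner ℝ b z - c * (‖z‖ ^ 2 - 4)) / (‖z‖ ^ 2 + 4)

omit [FiniteDimensional ℝ F] in
theorem contDiff_linearFormLocal (b : F) (c : ℝ) : ContDiff ℝ ∞ (linearFormLocal b c) := by
  refine ContDiff.div ?_ ((contDiff_norm_sq ℝ).add contDiff_const) fun z => by positivity
  exact (contDiff_const.mul (contDiff_const.inner ℝ contDiff_id)).sub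
    (contDiff_const.mul ((contDiff_norm_sq ℝ).sub contDiff_const))

theorem gradientLocal_linearFormLocal (b : F) (c t : ℝ) (z : F) :
    gradientLocal (roundField F) (fun z => 1 + t * linearFormLocal b c z) z =
      t • (((‖z‖ ^ 2 + 4) / 4) • b - (c + inner ℝ b z / 2) • z) := by
  have hr : (0 : ℝ) < ‖z‖ ^ 2 + 4 := by positivity
  have h1 := ((flatForm F b).hasFDerivAt (x := z)).const_mul 4
  have h2 := (hasFDerivAt_norm_sq_add z (-4)).const_mul c
  have h3 := (((h1.sub h2).mul ((hasDerivAt_inv hr.ne').comp_hasFDerivAt z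
    (hasFDerivAt_norm_sq_add z 4))).const_mul t).const_add 1
  refine eq_of_forall_apply_eq (isMetricAt_roundField z).definite fun x => ?_
  rw [gradientLocal_spec (isMetricAt_roundField z).definite]
  have h4 : (fun z => 1 + t * linearFormLocal b c z) = fun z => 1 + t * ((4 * flatForm F b z
      - c * (‖z‖ ^ 2 + -4)) * (‖z‖ ^ 2 + 4)⁻¹) := by
    funext z
    simp [linearFormLocal, div_eq_mul_inv, sub_eq_add_neg]
  rw [h4]
  erw [h3.fderiv]
  simp
  field_simp
  ring

theorem laplacianLocal_linearFormLocal (b : F) (c t : ℝ) :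
    laplacianLocal (roundField F) (fun z => 1 + t * linearFormLocal b c z) 0 =
      -(t * c * finrank ℝ F) := by
  have h1 := ((((hasFDerivAt_norm_sq_add (0 : F) 4).mul_const (4⁻¹ : ℝ)).smul_const b).sub
    (((((flatForm F b).hasFDerivAt (x := 0)).mul_const (2⁻¹ : ℝ)).const_add c).smul
      (hasFDerivAt_id (0 : F)))).const_smul t
  have key : covariantDeriv (roundField F)
      (gradientLocal (roundField F) fun z => 1 + t * linearFormLocal b c z) 0 =
      (-(t * c)) • LinearMap.id := by
    ext v
    rw [covariantDeriv_apply, christoffel_roundField_zero, funext (gradientLocal_linearFormLocal b c t)]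
    simp only [div_eq_mul_inv]
    erw [h1.fderiv]
    simp [smul_smul]
  rw [laplacianLocal, key, map_smul, LinearMap.trace_id, smul_eq_mul]
  ring

end Round

section Density

variable {E : Type*} [NormedAddCommGroup E] [NormedSpace ℝ E]
  {ι : Type*} [Fintype ι] [DecidableEq ι] (b : Basis ι ℝ E)

theorem volumeDensity_bilinearComp (G G' : E → E →L[ℝ] E →L[ℝ] ℝ) (y y' : E) (D : E →L[ℝ] E)
    (h : G y = (G' y').bilinearComp D D) :
    volumeDensity b G y = |D.det| * volumeDensity b G' y' := by
  have hM : (Matrix.of fun i j => G y (b i) (b j)) =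
      (LinearMap.toMatrix b b (D : E →ₗ[ℝ] E)).transpose
        * (Matrix.of fun i j => G' y' (b i) (b j)) * LinearMap.toMatrix b b (D : E →ₗ[ℝ] E) := by
    ext i j
    have hD : ∀ i, D (b i) = ∑ k, LinearMap.toMatrix b b (D : E →ₗ[ℝ] E) k i • b k := fun i => by
      simp only [LinearMap.toMatrix_apply]
      exact (b.sum_repr (D (b i))).symm
    rw [Matrix.of_apply, h]
    change G' y' (D (b i)) (D (b j)) = _
    rw [hD i, hD j]
    simp only [map_sum, map_smul, sum_apply, smul_apply, smul_eq_mul,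
      Matrix.mul_apply, Matrix.transpose_apply, Matrix.of_apply, Finset.sum_mul, Finset.mul_sum]
    refine Finset.sum_congr rfl fun k _ => Finset.sum_congr rfl fun l _ => ?_
    ring
  unfold volumeDensity
  rw [hM, Matrix.det_mul, Matrix.det_mul, Matrix.det_transpose, LinearMap.det_toMatrix]
  change √((D.det : ℝ) * _ * (D.det : ℝ)) = _
  rw [mul_right_comm, ← sq, Real.sqrt_mul (sq_nonneg _), Real.sqrt_sq_eq_abs]

theorem volumeDensity_smul (G G' : E → E →L[ℝ] E →L[ℝ] ℝ) (y : E) {c : ℝ} (hc : 0 ≤ c)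
    (h : G y = c • G' y) :
    volumeDensity b G y = c ^ ((finrank ℝ E : ℝ) / 2) * volumeDensity b G' y := by
  have hM : (Matrix.of fun i j => G y (b i) (b j)) = c • Matrix.of fun i j => G' y (b i) (b j) := by
    ext i j
    simp [h]
  unfold volumeDensity
  rw [hM, Matrix.det_smul, Real.sqrt_mul (by positivity), ← finrank_eq_card_basis b,
    Real.sqrt_eq_rpow, ← Real.rpow_natCast, ← Real.rpow_mul hc]
  congr 2
  ring

theorem IsMetricAt.volumeDensity_pos {G : E → E →L[ℝ] E →L[ℝ] ℝ} {y : E} (h : IsMetricAt G y) :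
    0 < volumeDensity b G y := by
  refine Real.sqrt_pos.2 (Matrix.PosDef.det_pos ?_)
  refine Matrix.PosDef.of_dotProduct_mulVec_pos ?_ fun x hx => ?_
  · ext i j
    simp [h.symm.self_of_nhds (b i) (b j)]
  · have hne : b.equivFun.symm x ≠ 0 := by
      rwa [Ne, LinearEquiv.map_eq_zero_iff]
    have := h.pos.self_of_nhds _ hne
    rw [Basis.equivFun_symm_apply] at this
    simp only [map_sum, map_smul, sum_apply, smul_apply, smul_eq_mul] at this
    simp only [dotProduct, Matrix.mulVec, Matrix.of_apply, Finset.mul_sum, star_trivial]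
    refine this.trans_eq ?_
    simp only [Finset.mul_sum]
    refine Finset.sum_congr rfl fun k _ => Finset.sum_congr rfl fun l _ => ?_
    rw [h.symm.self_of_nhds (b k)]
    ring

theorem continuousAt_volumeDensity {G : E → E →L[ℝ] E →L[ℝ] ℝ} {y : E} (h : ContinuousAt G y) :
    ContinuousAt (volumeDensity b G) y := by
  unfold volumeDensity
  refine Real.continuous_sqrt.continuousAt.comp ?_
  refine ContinuousAt.comp (f := fun z => Matrix.of fun i j => G z (b i) (b j)) (g := Matrix.det) (Continuous.matrix_det continuous_id).continuousAt ?_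
  refine continuousAt_pi.2 fun i => continuousAt_pi.2 fun j => ?_
  exact (h.clm_apply continuousAt_const).clm_apply continuousAt_const

end Density

section Pullback

variable {E : Type*} [NormedAddCommGroup E] [NormedSpace ℝ E]
  {H : Type*} [TopologicalSpace H] {I : ModelWithCorners ℝ E H}
  {M : Type*} [TopologicalSpace M] [ChartedSpace H M]
  {E' : Type*} [NormedAddCommGroup E'] [NormedSpace ℝ E']
  {H' : Type*} [TopologicalSpace H'] {J : ModelWithCorners ℝ E' H'}
  {N : Type*} [TopologicalSpace N] [ChartedSpace H' N]
  {E'' : Type*} [NormedAddCommGroup E''] [NormedSpace ℝ E'']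
  {H'' : Type*} [TopologicalSpace H''] {K : ModelWithCorners ℝ E'' H''}
  {P : Type*} [TopologicalSpace P] [ChartedSpace H'' P]

theorem pullback_congr {f f' : M → N} {x : M} (h : f =ᶠ[𝓝 x] f') (g : FormField J N) :
    pullback I f g x = pullback I f' g x := by
  have h1 : (mfderiv I J f x : E →L[ℝ] E') = mfderiv I J f' x := h.mfderiv_eq
  have h2 : (g (f x) : E' →L[ℝ] E' →L[ℝ] ℝ) = g (f' x) :=
    congrArg (fun z : N => (show E' →L[ℝ] E' →L[ℝ] ℝ from g z)) h.eq_of_nhds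
  unfold pullback
  simp only
  rw [h1, h2]

theorem pullback_comp {f : M → N} {h : N → P} {x : M} (hh : MDifferentiableAt J K h (f x))
    (hf : MDifferentiableAt I J f x) (g : FormField K P) :
    pullback I (h ∘ f) g x = pullback I f (pullback J h g) x := by
  have h1 : (mfderiv I K (h ∘ f) x : E →L[ℝ] E'') =
    (mfderiv J K h (f x) : E' →L[ℝ] E'').comp (mfderiv I J f x : E →L[ℝ] E') := mfderiv_comp x hh hf
  unfold pullback
  simp only
  rw [h1]
  rfl

end Pullback

section Volume

variable {E : Type*} [NormedAddCommGroup E] [NormedSpace ℝ E] [FiniteDimensional ℝ E]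
  [MeasurableSpace E] [BorelSpace E]
  {H : Type*} [TopologicalSpace H] {I : ModelWithCorners ℝ E H} [I.Boundaryless]
  {X : Type*} [TopologicalSpace X] [ChartedSpace H X] [IsManifold I ∞ X]
  [MeasurableSpace X] [BorelSpace X]

omit [FiniteDimensional ℝ E] [MeasurableSpace E] [BorelSpace E] [MeasurableSpace X]
  [BorelSpace X] in
theorem mdifferentiableAt_extChartAt_symm {x₀ : X} {y : E} (hy : y ∈ (extChartAt I x₀).target) :
    MDifferentiableAt 𝓘(ℝ, E) I (extChartAt I x₀).symm y :=
  (((contMDiffOn_extChartAt_symm (n := ∞) x₀) y hy).contMDiffAt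
    ((isOpen_extChartAt_target x₀).mem_nhds hy)).mdifferentiableAt (by simp)

omit [FiniteDimensional ℝ E] [MeasurableSpace E] [BorelSpace E] [MeasurableSpace X]
  [BorelSpace X] in
/-- The transformation of a form field under a change of charts. -/
theorem inChart_eq_bilinearComp (g : FormField I X) {x₀ x₁ : X} {y : E}
    (hy : y ∈ ((extChartAt I x₀).symm ≫ extChartAt I x₁).source) :
    inChart g x₀ y = (inChart g x₁ (extChartAt I x₁ ((extChartAt I x₀).symm y))).bilinearComp
      (fderiv ℝ (extChartAt I x₁ ∘ (extChartAt I x₀).symm) y)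
      (fderiv ℝ (extChartAt I x₁ ∘ (extChartAt I x₀).symm) y) := by
  have hy0 : y ∈ (extChartAt I x₀).target := hy.1
  have hy1 : (extChartAt I x₀).symm y ∈ (extChartAt I x₁).source := hy.2
  have hd0 := mdifferentiableAt_extChartAt_symm hy0
  have hs : (extChartAt I x₁).source ∈ 𝓝 ((extChartAt I x₀).symm y) :=
    (isOpen_extChartAt_source x₁).mem_nhds hy1
  have hd1 : MDifferentiableAt I 𝓘(ℝ, E) (extChartAt I x₁) ((extChartAt I x₀).symm y) :=
    (contMDiffAt_extChartAt' (n := ∞) (by rwa [← extChartAt_source I])).mdifferentiableAt (by simp)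
  have hd2 := mdifferentiableAt_extChartAt_symm ((extChartAt I x₁).map_source hy1)
  have he : (extChartAt I x₀).symm =ᶠ[𝓝 y] (extChartAt I x₁).symm ∘
      (extChartAt I x₁ ∘ (extChartAt I x₀).symm) := by
    filter_upwards [hd0.continuousAt.preimage_mem_nhds hs] with z hz
    exact ((extChartAt I x₁).left_inv hz).symm
  have h1 := pullback_congr (I := 𝓘(ℝ, E)) he g
  rw [pullback_comp (f := extChartAt I x₁ ∘ (extChartAt I x₀).symm) hd2 (hd1.comp y hd0)] at h1
  have h2 : (mfderiv 𝓘(ℝ, E) 𝓘(ℝ, E) (extChartAt I x₁ ∘ (extChartAt I x₀).symm) y : E →L[ℝ] E) =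
      fderiv ℝ (extChartAt I x₁ ∘ (extChartAt I x₀).symm) y := mfderiv_eq_fderiv
  rw [← h2]
  exact h1

omit [IsManifold I ∞ X] in
theorem chartVolume_apply (g : FormField I X) (x₀ : X) {A : Set X} (hA : MeasurableSet A) :
    chartVolume g x₀ A = ∫⁻ y in (extChartAt I x₀).symm ⁻¹' A ∩ (extChartAt I x₀).target,
      ENNReal.ofReal (volumeDensity (finBasis ℝ E) (inChart g x₀) y) ∂(finBasis ℝ E).addHaar := by
  have ht := (isOpen_extChartAt_target (I := I) x₀).measurableSet
  have hm : AEMeasurable (extChartAt I x₀).symm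
      ((finBasis ℝ E).addHaar.restrict (extChartAt I x₀).target) :=
    (continuousOn_extChartAt_symm x₀).aemeasurable₀ ht.nullMeasurableSet
  rw [chartVolume, Measure.map_apply_of_aemeasurable
    (hm.mono_ac (withDensity_absolutelyContinuous _ _)) hA, withDensity_apply',
    Measure.restrict_restrict' ht]

omit [FiniteDimensional ℝ E] [IsManifold I ∞ X] in
theorem measurableSet_preimage_extChartAt_symm (x₀ : X) {A : Set X} (hA : MeasurableSet A) :
    MeasurableSet ((extChartAt I x₀).symm ⁻¹' A ∩ (extChartAt I x₀).target) := by
  have ht := (isOpen_extChartAt_target (I := I) x₀).measurableSet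
  have := (continuousOn_extChartAt_symm (I := I) x₀).domRestrict.measurable hA
  have h2 := (MeasurableEmbedding.subtype_coe ht).measurableSet_image.2 this
  convert h2 using 1
  ext y
  simp [and_comm]

theorem chartVolume_eq_of_subset (g : FormField I X) (x₀ x₁ : X) {A : Set X} (hA : MeasurableSet A)
    (h₀ : A ⊆ (extChartAt I x₀).source) (h₁ : A ⊆ (extChartAt I x₁).source) :
    chartVolume g x₀ A = chartVolume g x₁ A := by
  rw [chartVolume_apply g x₀ hA, chartVolume_apply g x₁ hA]
  set S := (extChartAt I x₀).symm ⁻¹' A ∩ (extChartAt I x₀).target with hS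
  set τ := extChartAt I x₁ ∘ (extChartAt I x₀).symm with hτ
  have hsrc : ∀ y ∈ S, y ∈ ((extChartAt I x₀).symm ≫ extChartAt I x₁).source := fun y hy =>
    ⟨hy.2, h₁ hy.1⟩
  have himg : τ '' S = (extChartAt I x₁).symm ⁻¹' A ∩ (extChartAt I x₁).target := by
    ext z
    constructor
    · rintro ⟨y, hy, rfl⟩
      refine ⟨?_, (extChartAt I x₁).map_source (h₁ hy.1)⟩
      rw [mem_preimage, hτ, Function.comp_apply, (extChartAt I x₁).left_inv (h₁ hy.1)]
      exact hy.1
    · rintro ⟨hz, hz'⟩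
      refine ⟨extChartAt I x₀ ((extChartAt I x₁).symm z), ⟨?_, (extChartAt I x₀).map_source (h₀ hz)⟩, ?_⟩
      · rwa [mem_preimage, (extChartAt I x₀).left_inv (h₀ hz)]
      · rw [hτ, Function.comp_apply, (extChartAt I x₀).left_inv (h₀ hz),
          (extChartAt I x₁).right_inv hz']
  have hinj : InjOn τ S := by
    intro a ha b hb hab
    have := (extChartAt I x₁).injOn (h₁ ha.1) (h₁ hb.1) hab
    exact (extChartAt I x₀).symm.injOn ha.2 hb.2 this
  have hder : ∀ y ∈ S, HasFDerivWithinAt τ (fderiv ℝ τ y) S y := by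
    intro y hy
    have hd0 := mdifferentiableAt_extChartAt_symm hy.2
    have hd1 : MDifferentiableAt I 𝓘(ℝ, E) (extChartAt I x₁) ((extChartAt I x₀).symm y) :=
      (contMDiffAt_extChartAt' (n := ∞) (by
        rw [← extChartAt_source I]; exact h₁ hy.1)).mdifferentiableAt (by simp)
    exact (hd1.comp y hd0).differentiableAt.hasFDerivAt.hasFDerivWithinAt
  rw [← himg, lintegral_image_eq_lintegral_abs_det_fderiv_mul _
    (measurableSet_preimage_extChartAt_symm x₀ hA) hder hinj]
  refine setLIntegral_congr_fun (measurableSet_preimage_extChartAt_symm x₀ hA) fun y hy => ?_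
  rw [volumeDensity_bilinearComp _ _ _ _ _ _ (inChart_eq_bilinearComp g (hsrc y hy)),
    ENNReal.ofReal_mul (abs_nonneg _)]
  rfl

omit [IsManifold I ∞ X] in
theorem chartVolume_inter_source (g : FormField I X) (x₀ : X) {A : Set X} (hA : MeasurableSet A) :
    chartVolume g x₀ (A ∩ (extChartAt I x₀).source) = chartVolume g x₀ A := by
  rw [chartVolume_apply g x₀ hA,
    chartVolume_apply g x₀ (hA.inter (isOpen_extChartAt_source x₀).measurableSet)]
  congr 2
  ext y
  have := (extChartAt I x₀).map_target (x := y)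
  simp only [mem_inter_iff, mem_preimage]
  tauto

/-- On a chart domain, the Riemannian measure is given by the density in that chart. -/
theorem volumeMeasure_apply_of_subset (g : FormField I X) (x₀ : X) {A : Set X}
    (hA : MeasurableSet A) (h₀ : A ⊆ (extChartAt I x₀).source) :
    volumeMeasure g A = chartVolume g x₀ A := by
  refine le_antisymm ?_ (le_iSup (chartVolume g) x₀ A)
  have hs : ∀ x : X, MeasurableSet (extChartAt I x).source := fun x =>
    (isOpen_extChartAt_source x).measurableSet
  have hle : volumeMeasure g ≤
      chartVolume g x₀ + (⊤ : Measure X).restrict ((extChartAt I x₀).source)ᶜ := by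
    refine iSup_le fun x₁ => Measure.le_iff.2 fun B hB => ?_
    rw [← measure_inter_add_sdiff B (hs x₀), Measure.add_apply, Measure.restrict_apply hB]
    refine add_le_add ?_ ?_
    · rw [← chartVolume_inter_source g x₁ (hB.inter (hs x₀)),
        chartVolume_eq_of_subset g x₁ x₀ ((hB.inter (hs x₀)).inter (hs x₁)) inter_subset_right
          (inter_subset_left.trans inter_subset_right)]
      exact measure_mono (inter_subset_left.trans inter_subset_left)
    · rw [sdiff_eq]
      exact (le_top : chartVolume g x₁ ≤ ⊤) _
  refine (hle A).trans ?_
  rw [Measure.add_apply, Measure.restrict_apply hA, (disjoint_compl_right_iff_subset.2 h₀).inter_eq]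
  simp

end Volume

section Riemannian

variable {E : Type*} [NormedAddCommGroup E] [NormedSpace ℝ E] [FiniteDimensional ℝ E]
  {H : Type*} [TopologicalSpace H] {I : ModelWithCorners ℝ E H}
  {X : Type*} [TopologicalSpace X] [ChartedSpace H X]

omit [FiniteDimensional ℝ E] in
/-- The form field `g` is a smooth Riemannian metric: it is one in every preferred chart. -/
def IsRiemannian (g : FormField I X) : Prop :=
  ∀ x₀ : X, ∀ y ∈ (extChartAt I x₀).target, IsMetricAt (inChart g x₀) y

variable [MeasurableSpace E] [BorelSpace E] [I.Boundaryless] [IsManifold I ∞ X]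
  [MeasurableSpace X] [BorelSpace X] {g : FormField I X}

omit [MeasurableSpace E] [BorelSpace E] [I.Boundaryless] [IsManifold I ∞ X] [MeasurableSpace X]
  [BorelSpace X] in
theorem IsRiemannian.continuousAt_volumeDensity (hg : IsRiemannian g) {x₀ : X} {y : E}
    (hy : y ∈ (extChartAt I x₀).target) :
    ContinuousAt (volumeDensity (finBasis ℝ E) (inChart g x₀)) y :=
  RiemannianYamabe.continuousAt_volumeDensity _ (hg x₀ y hy).contDiffAt.continuousAt

theorem IsRiemannian.isLocallyFiniteMeasure (hg : IsRiemannian g) :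
    IsLocallyFiniteMeasure (volumeMeasure g) := by
  refine ⟨fun x₀ => ?_⟩
  set y₀ := extChartAt I x₀ x₀
  set d := volumeDensity (finBasis ℝ E) (inChart g x₀)
  have hy₀ : y₀ ∈ (extChartAt I x₀).target := mem_extChartAt_target x₀
  have h1 : ∀ᶠ y in 𝓝 y₀, d y < d y₀ + 1 :=
    (hg.continuousAt_volumeDensity hy₀).eventually (gt_mem_nhds (lt_add_one _))
  obtain ⟨r, hr, hball⟩ := Metric.eventually_nhds_iff_ball.1 h1
  set U := (extChartAt I x₀).source ∩ extChartAt I x₀ ⁻¹' Metric.ball y₀ r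
  have hU : IsOpen U :=
    (continuousOn_extChartAt x₀).isOpen_inter_preimage (isOpen_extChartAt_source x₀)
      Metric.isOpen_ball
  refine ⟨U, hU.mem_nhds ⟨mem_extChartAt_source x₀, Metric.mem_ball_self hr⟩, ?_⟩
  rw [volumeMeasure_apply_of_subset g x₀ hU.measurableSet inter_subset_left,
    chartVolume_apply g x₀ hU.measurableSet]
  have hsub : (extChartAt I x₀).symm ⁻¹' U ∩ (extChartAt I x₀).target ⊆ Metric.ball y₀ r := by
    rintro y ⟨hy, hy'⟩
    simpa only [mem_preimage, (extChartAt I x₀).right_inv hy'] using hy.2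
  calc _ ≤ ∫⁻ y in Metric.ball y₀ r, ENNReal.ofReal (d y) ∂(finBasis ℝ E).addHaar :=
        lintegral_mono_set hsub
    _ ≤ ∫⁻ y in Metric.ball y₀ r, ENNReal.ofReal (d y₀ + 1) ∂(finBasis ℝ E).addHaar :=
        setLIntegral_mono measurable_const fun y hy => ENNReal.ofReal_le_ofReal (hball y hy).le
    _ < ⊤ := by
        rw [setLIntegral_const]
        exact ENNReal.mul_lt_top ENNReal.ofReal_lt_top measure_ball_lt_top

omit [IsManifold I ∞ X] in
theorem IsRiemannian.isOpenPosMeasure (hg : IsRiemannian g) :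
    (volumeMeasure g).IsOpenPosMeasure := by
  refine ⟨fun U hU ⟨x₀, hx₀⟩ => ?_⟩
  set y₀ := extChartAt I x₀ x₀
  set d := volumeDensity (finBasis ℝ E) (inChart g x₀)
  have hy₀ : y₀ ∈ (extChartAt I x₀).target := mem_extChartAt_target x₀
  have hd : 0 < d y₀ := (hg x₀ y₀ hy₀).volumeDensity_pos _
  have h1 : ∀ᶠ y in 𝓝 y₀, d y₀ / 2 < d y :=
    (hg.continuousAt_volumeDensity hy₀).eventually (lt_mem_nhds (half_lt_self hd))
  have h2 : ∀ᶠ y in 𝓝 y₀, y ∈ (extChartAt I x₀).symm ⁻¹' U ∩ (extChartAt I x₀).target := by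
    refine Filter.inter_mem ?_ (extChartAt_target_mem_nhds x₀)
    exact (continuousAt_extChartAt_symm x₀).preimage_mem_nhds
      (hU.mem_nhds (by rwa [extChartAt_to_inv]))
  obtain ⟨r, hr, hball⟩ := Metric.eventually_nhds_iff_ball.1 (h1.and h2)
  refine ne_of_gt (lt_of_lt_of_le ?_ (le_iSup (chartVolume g) x₀ U))
  rw [chartVolume_apply g x₀ hU.measurableSet]
  calc (0 : ENNReal) < ENNReal.ofReal (d y₀ / 2) * (finBasis ℝ E).addHaar (Metric.ball y₀ r) :=
        ENNReal.mul_pos (by simpa using hd) (Metric.measure_ball_pos _ _ hr).ne'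
    _ = ∫⁻ y in Metric.ball y₀ r, ENNReal.ofReal (d y₀ / 2) ∂(finBasis ℝ E).addHaar := by
        rw [setLIntegral_const]
    _ ≤ ∫⁻ y in Metric.ball y₀ r, ENNReal.ofReal (d y) ∂(finBasis ℝ E).addHaar :=
        setLIntegral_mono' Metric.isOpen_ball.measurableSet
          fun y hy => ENNReal.ofReal_le_ofReal (hball y hy).1.le
    _ ≤ _ := lintegral_mono_set fun y hy => (hball y hy).2

omit [FiniteDimensional ℝ E] [MeasurableSpace E] [BorelSpace E] [I.Boundaryless]
  [IsManifold I ∞ X] [MeasurableSpace X] [BorelSpace X] in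
theorem inChart_conformal (φ : X → ℝ) (g : FormField I X) (x₀ : X) :
    inChart (conformal φ g) x₀ =
      fun y => φ ((extChartAt I x₀).symm y) • inChart g x₀ y := rfl

omit [IsManifold I ∞ X] in
theorem IsRiemannian.chartVolume_conformal (hg : IsRiemannian g) {φ : X → ℝ} (hφ : Continuous φ)
    (hpos : ∀ x, 0 < φ x) (x₀ : X) :
    chartVolume (conformal φ g) x₀ = (chartVolume g x₀).withDensity
      (fun x => ENNReal.ofReal (φ x ^ ((finrank ℝ E : ℝ) / 2))) := by
  have ht := (isOpen_extChartAt_target (I := I) x₀).measurableSet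
  have hmeas : Measurable fun x => ENNReal.ofReal (φ x ^ ((finrank ℝ E : ℝ) / 2)) :=
    (hφ.rpow_const fun x => .inl (hpos x).ne').measurable.ennreal_ofReal
  have hm : AEMeasurable (extChartAt I x₀).symm
      ((finBasis ℝ E).addHaar.restrict (extChartAt I x₀).target) :=
    (continuousOn_extChartAt_symm x₀).aemeasurable₀ ht.nullMeasurableSet
  have hd : AEMeasurable
      (fun y => ENNReal.ofReal (volumeDensity (finBasis ℝ E) (inChart g x₀) y))
      ((finBasis ℝ E).addHaar.restrict (extChartAt I x₀).target) := by
    refine AEMeasurable.ennreal_ofReal (ContinuousOn.aemeasurable₀ ?_ ht.nullMeasurableSet)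
    exact fun y hy => (hg.continuousAt_volumeDensity hy).continuousWithinAt
  ext A hA
  have hc : AEMeasurable (fun y => A.indicator
      (fun x => ENNReal.ofReal (φ x ^ ((finrank ℝ E : ℝ) / 2))) ((extChartAt I x₀).symm y))
      ((finBasis ℝ E).addHaar.restrict (extChartAt I x₀).target) :=
    (hmeas.indicator hA).comp_aemeasurable hm
  rw [withDensity_apply _ hA, ← lintegral_indicator hA, chartVolume_apply _ x₀ hA]
  conv_rhs => rw [chartVolume]
  rw [lintegral_map' (hmeas.indicator hA).aemeasurable
      (hm.mono_ac (withDensity_absolutelyContinuous _ _)),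
    lintegral_withDensity_eq_lintegral_mul₀ hd hc,
    ← lintegral_indicator (measurableSet_preimage_extChartAt_symm x₀ hA), ← lintegral_indicator ht]
  congr 1
  funext y
  by_cases hy : y ∈ (extChartAt I x₀).target
  · by_cases hy' : (extChartAt I x₀).symm y ∈ A
    · have h1 : y ∈ (extChartAt I x₀).symm ⁻¹' A ∩ (extChartAt I x₀).target := ⟨hy', hy⟩
      rw [indicator_of_mem h1, indicator_of_mem hy, Pi.mul_apply, indicator_of_mem hy',
        volumeDensity_smul (finBasis ℝ E) (inChart (conformal φ g) x₀) (inChart g x₀) y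
          (hpos _).le (congrFun (inChart_conformal φ g x₀) y),
        ENNReal.ofReal_mul (Real.rpow_nonneg (hpos _).le _), mul_comm]
    · have h1 : y ∉ (extChartAt I x₀).symm ⁻¹' A ∩ (extChartAt I x₀).target := fun h => hy' h.1
      rw [indicator_of_notMem h1, indicator_of_mem hy, Pi.mul_apply, indicator_of_notMem hy',
        mul_zero]
  · have h1 : y ∉ (extChartAt I x₀).symm ⁻¹' A ∩ (extChartAt I x₀).target := fun h => hy h.2
    rw [indicator_of_notMem h1, indicator_of_notMem hy]

theorem withDensity_mono_left {α : Type*} [MeasurableSpace α] {μ ν : Measure α} (h : μ ≤ ν)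
    (f : α → ENNReal) : μ.withDensity f ≤ ν.withDensity f :=
  Measure.le_iff.2 fun s hs => by
    rw [withDensity_apply _ hs, withDensity_apply _ hs]
    exact lintegral_mono' (Measure.restrict_mono_measure h s) le_rfl

omit [IsManifold I ∞ X] in
/-- The Riemannian measure of a conformal metric. -/
theorem IsRiemannian.volumeMeasure_conformal (hg : IsRiemannian g) {φ : X → ℝ} (hφ : Continuous φ)
    (hpos : ∀ x, 0 < φ x) :
    volumeMeasure (conformal φ g) = (volumeMeasure g).withDensity
      (fun x => ENNReal.ofReal (φ x ^ ((finrank ℝ E : ℝ) / 2))) := by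
  set f : X → ENNReal := fun x => ENNReal.ofReal (φ x ^ ((finrank ℝ E : ℝ) / 2)) with hf
  have hmeas : Measurable f :=
    (hφ.rpow_const fun x => .inl (hpos x).ne').measurable.ennreal_ofReal
  have hf0 : ∀ x, f x ≠ 0 := fun x => by
    simpa [hf] using Real.rpow_pos_of_pos (hpos x) _
  have hft : ∀ x, f x ≠ ⊤ := fun x => ENNReal.ofReal_ne_top
  have hchart : ∀ x, chartVolume (conformal φ g) x = (chartVolume g x).withDensity f :=
    hg.chartVolume_conformal hφ hpos
  refine le_antisymm (iSup_le fun x => ?_) ?_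
  · rw [hchart]
    exact withDensity_mono_left (le_iSup (chartVolume g) x) f
  · have h1 : volumeMeasure g ≤ (volumeMeasure (conformal φ g)).withDensity f⁻¹ := by
      refine iSup_le fun x => ?_
      rw [← withDensity_inv_same (μ := chartVolume g x) hmeas (.of_forall hf0) (.of_forall hft),
        ← hchart]
      exact withDensity_mono_left (le_iSup (chartVolume (conformal φ g)) x) _
    refine (withDensity_mono_left h1 f).trans_eq ?_
    have h2 := withDensity_inv_same (μ := volumeMeasure (conformal φ g)) (f := f⁻¹) hmeas.inv
      (.of_forall fun x => ENNReal.inv_ne_zero.2 (hft x))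
      (.of_forall fun x => ENNReal.inv_ne_top.2 (hf0 x))
    simpa only [Pi.inv_apply, inv_inv] using h2

omit [IsManifold I ∞ X] in
theorem IsRiemannian.integral_volumeMeasure_conformal (hg : IsRiemannian g) {φ : X → ℝ}
    (hφ : Continuous φ) (hpos : ∀ x, 0 < φ x) (F : X → ℝ) :
    ∫ x, F x ∂(volumeMeasure (conformal φ g)) =
      ∫ x, φ x ^ ((finrank ℝ E : ℝ) / 2) * F x ∂(volumeMeasure g) := by
  rw [hg.volumeMeasure_conformal hφ hpos]
  have hc : Continuous fun x => φ x ^ ((finrank ℝ E : ℝ) / 2) :=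
    hφ.rpow_const fun x => .inl (hpos x).ne'
  rw [integral_withDensity_eq_integral_toReal_smul hc.measurable.ennreal_ofReal
    (.of_forall fun x => ENNReal.ofReal_lt_top)]
  refine integral_congr_ae (.of_forall fun x => ?_)
  simp only [ENNReal.toReal_ofReal (Real.rpow_nonneg (hpos x).le _), smul_eq_mul]

end Riemannian

section RiemannianMetric

variable {E : Type*} [NormedAddCommGroup E] [NormedSpace ℝ E] [FiniteDimensional ℝ E]
  {H : Type*} [TopologicalSpace H] {I : ModelWithCorners ℝ E H} [I.Boundaryless]
  {M : Type*} [TopologicalSpace M] [ChartedSpace H M] [IsManifold I ∞ M]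

omit [FiniteDimensional ℝ E] in
theorem contDiffAt_inChart_apply
    (g : Bundle.ContMDiffRiemannianMetric I ∞ E (fun x : M => TangentSpace I x)) (x₀ : M) {y : E}
    (hy : y ∈ (extChartAt I x₀).target) (v w : E) :
    ContDiffAt ℝ ∞ (fun z => inChart (formField g) x₀ z v w) y := by
  have ho := isOpen_extChartAt_target (I := I) x₀
  have hψ : ContMDiffAt 𝓘(ℝ, E) I ∞ (extChartAt I x₀).symm y :=
    ((contMDiffOn_extChartAt_symm (n := ∞) x₀) y hy).contMDiffAt (ho.mem_nhds hy)
  have hsec : ∀ v : E, ContMDiffAt 𝓘(ℝ, E) I.tangent ∞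
      (fun z => (⟨(extChartAt I x₀).symm z, mfderiv 𝓘(ℝ, E) I (extChartAt I x₀).symm z v⟩ :
        TangentBundle I M)) y := by
    intro v
    have h1 := (contMDiffOn_extChartAt_symm (n := ∞) x₀).contMDiffOn_tangentMapWithin (m := ∞)
      (by simp) ho.uniqueMDiffOn
    have h2 : ContMDiffAt 𝓘(ℝ, E) 𝓘(ℝ, E).tangent ∞
        (fun z => (⟨z, v⟩ : TangentBundle 𝓘(ℝ, E) E)) y :=
      contMDiffAt_vectorSpace_iff_contDiffAt.2 contDiffAt_const
    have h3 := (h1 ⟨y, v⟩ hy).contMDiffAt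
      ((ho.preimage (FiberBundle.continuous_proj E _)).mem_nhds hy)
    refine (h3.comp y h2).congr_of_eventuallyEq ?_
    filter_upwards [ho.mem_nhds hy] with z hz
    simp only [Function.comp_apply, tangentMapWithin, mfderivWithin_of_isOpen ho hz]
  have : ContMDiffAt 𝓘(ℝ, E) (I.prod 𝓘(ℝ)) ∞
      (fun z => Bundle.TotalSpace.mk' ℝ (E := Bundle.Trivial M ℝ) ((extChartAt I x₀).symm z)
        (g.inner ((extChartAt I x₀).symm z) (mfderiv 𝓘(ℝ, E) I (extChartAt I x₀).symm z v)
          (mfderiv 𝓘(ℝ, E) I (extChartAt I x₀).symm z w))) y := by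
    apply ContMDiffAt.clm_bundle_apply₂ (F₁ := E) (F₂ := E)
    · exact g.contMDiff.contMDiffAt.comp y hψ
    · exact hsec v
    · exact hsec w
  simp only [Bundle.contMDiffAt_totalSpace] at this
  exact this.2.contDiffAt

omit [FiniteDimensional ℝ E] in
theorem mfderiv_extChartAt_symm_ne_zero {x₀ : M} {y : E} (hy : y ∈ (extChartAt I x₀).target)
    {v : E} (hv : v ≠ 0) : mfderiv 𝓘(ℝ, E) I (extChartAt I x₀).symm y v ≠ 0 := by
  intro h0
  have hd := mdifferentiableAt_extChartAt_symm hy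
  have hd1 : MDifferentiableAt I 𝓘(ℝ, E) (extChartAt I x₀) ((extChartAt I x₀).symm y) :=
    (contMDiffAt_extChartAt' (n := ∞) (by
      rw [← extChartAt_source I]; exact (extChartAt I x₀).map_target hy)).mdifferentiableAt (by simp)
  have h1 := mfderiv_comp y hd1 hd
  have he : extChartAt I x₀ ∘ (extChartAt I x₀).symm =ᶠ[𝓝 y] id := by
    filter_upwards [(isOpen_extChartAt_target x₀).mem_nhds hy] with z hz
    exact (extChartAt I x₀).right_inv hz
  rw [he.mfderiv_eq, mfderiv_id] at h1
  have h2 := congrArg (fun L : E →L[ℝ] E => L v) h1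
  apply hv
  refine h2.trans ?_
  change mfderiv I 𝓘(ℝ, E) (extChartAt I x₀) _ (mfderiv 𝓘(ℝ, E) I (extChartAt I x₀).symm y v) = 0
  rw [h0]
  exact map_zero _

theorem isRiemannian_formField
    (g : Bundle.ContMDiffRiemannianMetric I ∞ E (fun x : M => TangentSpace I x)) :
    IsRiemannian (formField g) := by
  intro x₀ y hy
  have ho := (isOpen_extChartAt_target (I := I) x₀).mem_nhds hy
  refine ⟨?_, ?_, ?_⟩
  · have hs : ContDiffOn ℝ ∞ (inChart (formField g) x₀) (extChartAt I x₀).target :=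
      contDiffOn_clm_apply.2 fun v => contDiffOn_clm_apply.2 fun w z hz =>
        (contDiffAt_inChart_apply g x₀ hz v w).contDiffWithinAt
    filter_upwards [ho] with z hz
    exact hs.contDiffAt ((isOpen_extChartAt_target x₀).mem_nhds hz)
  · filter_upwards [ho] with z hz v w
    exact g.symm _ _ _
  · filter_upwards [ho] with z hz v hv
    have := g.pos ((extChartAt I x₀).symm z) (mfderiv 𝓘(ℝ, E) I (extChartAt I x₀).symm z v)
      (mfderiv_extChartAt_symm_ne_zero hz hv)
    exact this

end RiemannianMetric

section ProductMetric

variable {E : Type*} [NormedAddCommGroup E] [NormedSpace ℝ E]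
  {H : Type*} [TopologicalSpace H] {I : ModelWithCorners ℝ E H} [I.Boundaryless]
  {M : Type*} [TopologicalSpace M] [ChartedSpace H M] [IsManifold I ∞ M]
  {E' : Type*} [NormedAddCommGroup E'] [NormedSpace ℝ E']
  {H' : Type*} [TopologicalSpace H'] {J : ModelWithCorners ℝ E' H'} [J.Boundaryless]
  {N : Type*} [TopologicalSpace N] [ChartedSpace H' N] [IsManifold J ∞ N]
  {g : FormField I M} {h : FormField J N}

theorem inChart_productMetric (g : FormField I M) (h : FormField J N) (p : M) (q : N) {y : E × E'}
    (hy : y ∈ (extChartAt (I.prod J) (p, q)).target) :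
    inChart (productMetric g h) (p, q) y = productField (inChart g p) (inChart h q) y := by
  have hy1 : y.1 ∈ (extChartAt I p).target := by
    rw [extChartAt_prod] at hy; exact hy.1
  have hy2 : y.2 ∈ (extChartAt J q).target := by
    rw [extChartAt_prod] at hy; exact hy.2
  have hd := mdifferentiableAt_extChartAt_symm hy
  have hd1 := mdifferentiableAt_extChartAt_symm hy1
  have hd2 := mdifferentiableAt_extChartAt_symm hy2
  have e1 : Prod.fst ∘ (extChartAt (I.prod J) (p, q)).symm = (extChartAt I p).symm ∘ Prod.fst := by
    rw [extChartAt_prod]; rfl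
  have e2 : Prod.snd ∘ (extChartAt (I.prod J) (p, q)).symm = (extChartAt J q).symm ∘ Prod.snd := by
    rw [extChartAt_prod]; rfl
  have f1 : MDifferentiableAt 𝓘(ℝ, E × E') 𝓘(ℝ, E) Prod.fst y :=
    differentiableAt_fst.mdifferentiableAt
  have f2 : MDifferentiableAt 𝓘(ℝ, E × E') 𝓘(ℝ, E') Prod.snd y :=
    differentiableAt_snd.mdifferentiableAt
  have k1 := pullback_comp (x := y) (mdifferentiableAt_fst (I := I) (I' := J)) hd g
  have k2 := pullback_comp (x := y) (mdifferentiableAt_snd (I := I) (I' := J)) hd h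
  rw [e1, pullback_comp hd1 f1] at k1
  rw [e2, pullback_comp hd2 f2] at k2
  have m1 : (mfderiv 𝓘(ℝ, E × E') 𝓘(ℝ, E) Prod.fst y : E × E' →L[ℝ] E) = .fst ℝ E E' := by
    rw [mfderiv_eq_fderiv]; exact fderiv_fst
  have m2 : (mfderiv 𝓘(ℝ, E × E') 𝓘(ℝ, E') Prod.snd y : E × E' →L[ℝ] E') = .snd ℝ E E' := by
    rw [mfderiv_eq_fderiv]; exact fderiv_snd
  have l1 : (pullback 𝓘(ℝ, E × E') Prod.fst
      (pullback 𝓘(ℝ, E) (extChartAt I p).symm g : FormField 𝓘(ℝ, E) E) y) =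
      (inChart g p y.1).bilinearComp (.fst ℝ E E') (.fst ℝ E E') := by
    rw [← m1]; rfl
  have l2 : (pullback 𝓘(ℝ, E × E') Prod.snd
      (pullback 𝓘(ℝ, E') (extChartAt J q).symm h : FormField 𝓘(ℝ, E') E') y) =
      (inChart h q y.2).bilinearComp (.snd ℝ E E') (.snd ℝ E E') := by
    rw [← m2]; rfl
  rw [l1] at k1
  rw [l2] at k2
  unfold productField
  rw [k1, k2]
  rfl

theorem IsRiemannian.productMetric (hg : IsRiemannian g) (hh : IsRiemannian h) :
    IsRiemannian (productMetric g h) := by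
  rintro ⟨p, q⟩ y hy
  have hy' := hy
  rw [extChartAt_prod] at hy'
  refine ((hg p y.1 hy'.1).productField (hh q y.2 hy'.2)).congr ?_
  filter_upwards [(isOpen_extChartAt_target (I := I.prod J) (p, q)).mem_nhds hy] with z hz
  exact inChart_productMetric g h p q hz

end ProductMetric

section Sphere

variable {m : ℕ}

theorem extChartAt_sphere_target (x : Sphere m) : (extChartAt (𝓡 m) x).target = univ := by
  have := Fact.mk (@finrank_euclideanSpace_fin ℝ _ (m + 1))
  rw [extChartAt_target]
  change 𝓘(ℝ, EuclideanSpace ℝ (Fin m)).symm ⁻¹' (stereographic' m (-x)).target ∩ _ = _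
  simp

theorem extChartAt_sphere_self (x : Sphere m) : extChartAt (𝓡 m) x x = 0 := by
  have := Fact.mk (@finrank_euclideanSpace_fin ℝ _ (m + 1))
  change stereographic' m (-x) x = 0
  have h := stereographic_neg_apply x
  change (OrthonormalBasis.fromOrthogonalSpanSingleton (𝕜 := ℝ) m
    (ne_zero_of_mem_unit_sphere (-x))).repr (stereographic (norm_eq_of_mem_sphere (-x)) x) = 0
  rw [h, map_zero]

theorem exists_extChartAt_sphere_symm_apply (x : Sphere m) :
    ∃ ι : EuclideanSpace ℝ (Fin m) →ₗᵢ[ℝ] EuclideanSpace ℝ (Fin (m + 1)),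
      (∀ y, inner ℝ (ι y) (x : EuclideanSpace ℝ (Fin (m + 1))) = 0) ∧
      ∀ y, (((extChartAt (𝓡 m) x).symm y : Sphere m) : EuclideanSpace ℝ (Fin (m + 1))) =
        (‖y‖ ^ 2 + 4)⁻¹ • ((4 : ℝ) • ι y - (‖y‖ ^ 2 + -4) • (x : EuclideanSpace ℝ (Fin (m + 1)))) := by
  have := Fact.mk (@finrank_euclideanSpace_fin ℝ _ (m + 1))
  let U := (OrthonormalBasis.fromOrthogonalSpanSingleton (𝕜 := ℝ) m
    (ne_zero_of_mem_unit_sphere (-x))).repr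
  refine ⟨(Submodule.subtypeₗᵢ _).comp U.symm.toLinearIsometry, fun y => ?_, fun y => ?_⟩
  · have := (U.symm y).2
    rw [Submodule.mem_orthogonal_singleton_iff_inner_left] at this
    change inner ℝ ((U.symm y : _) : EuclideanSpace ℝ (Fin (m + 1))) x.1 = 0
    simpa using this
  · have := stereographic'_symm_apply (-x) y
    refine this.trans ?_
    change (‖U.symm y‖ ^ 2 + 4)⁻¹ • (4 : ℝ) • (U.symm y : EuclideanSpace ℝ (Fin (m + 1)))
      + (‖U.symm y‖ ^ 2 + 4)⁻¹ • (‖U.symm y‖ ^ 2 - 4) • (-x).1 =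
      (‖y‖ ^ 2 + 4)⁻¹ • ((4 : ℝ) • (U.symm y : EuclideanSpace ℝ (Fin (m + 1)))
        - (‖y‖ ^ 2 + -4) • x.1)
    rw [LinearIsometryEquiv.norm_map]
    simp
    module

theorem inChart_roundMetric (x : Sphere m) :
    inChart (roundMetric m) x = roundField (EuclideanSpace ℝ (Fin m)) := by
  funext y
  have hy : y ∈ (extChartAt (𝓡 m) x).target := by rw [extChartAt_sphere_target]; trivial
  have := Fact.mk (@finrank_euclideanSpace_fin ℝ _ (m + 1))
  obtain ⟨ι, hι, hψ⟩ := exists_extChartAt_sphere_symm_apply x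
  have hd : MDifferentiableAt (𝓡 m) 𝓘(ℝ, EuclideanSpace ℝ (Fin (m + 1)))
      ((↑) : Sphere m → EuclideanSpace ℝ (Fin (m + 1))) ((extChartAt (𝓡 m) x).symm y) :=
    (contMDiff_coe_sphere (m := ∞)).contMDiffAt.mdifferentiableAt (by simp)
  have h1 := pullback_comp hd (mdifferentiableAt_extChartAt_symm hy) (euclideanMetric (m + 1))
  have hr : (0 : ℝ) < ‖y‖ ^ 2 + 4 := by positivity
  have hder := ((hasDerivAt_inv hr.ne').comp_hasFDerivAt y (hasFDerivAt_norm_sq_add y 4)).smul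
    ((ι.toContinuousLinearMap.hasFDerivAt.const_smul (4 : ℝ)).sub
      ((hasFDerivAt_norm_sq_add y (-4)).smul_const (x : EuclideanSpace ℝ (Fin (m + 1)))))
  let L : EuclideanSpace ℝ (Fin m) →L[ℝ] EuclideanSpace ℝ (Fin (m + 1)) :=
    mfderiv 𝓘(ℝ, EuclideanSpace ℝ (Fin m)) 𝓘(ℝ, EuclideanSpace ℝ (Fin (m + 1)))
      (((↑) : Sphere m → EuclideanSpace ℝ (Fin (m + 1))) ∘ (extChartAt (𝓡 m) x).symm) y
  have hmf : ∀ v, L v = (4 / (‖y‖ ^ 2 + 4)) • ι v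
      - (8 * inner ℝ y v / (‖y‖ ^ 2 + 4) ^ 2) • ι y
      - (16 * inner ℝ y v / (‖y‖ ^ 2 + 4) ^ 2) • (x : EuclideanSpace ℝ (Fin (m + 1))) := by
    intro v
    have e : ((↑) : Sphere m → EuclideanSpace ℝ (Fin (m + 1))) ∘ (extChartAt (𝓡 m) x).symm =
      fun y => (‖y‖ ^ 2 + 4)⁻¹ • ((4 : ℝ) • ι y
        - (‖y‖ ^ 2 + -4) • (x : EuclideanSpace ℝ (Fin (m + 1)))) := funext hψ
    have hL : L = fderiv ℝ (fun y => (‖y‖ ^ 2 + 4)⁻¹ • ((4 : ℝ) • ι y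
        - (‖y‖ ^ 2 + -4) • (x : EuclideanSpace ℝ (Fin (m + 1))))) y := by
      rw [← e]; exact mfderiv_eq_fderiv
    rw [hL]
    erw [hder.fderiv]
    simp
    match_scalars
    · field_simp
    · field_simp
      ring
    · field_simp
      ring
  ext v w
  have h2 := congrArg (fun B : EuclideanSpace ℝ (Fin m) →L[ℝ] EuclideanSpace ℝ (Fin m) →L[ℝ] ℝ =>
    B v w) h1
  refine h2.symm.trans ?_
  change inner ℝ (L v) (L w) = _
  rw [hmf, hmf, roundField_apply]
  have hx : ‖(x : EuclideanSpace ℝ (Fin (m + 1)))‖ = 1 := by simp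
  have hι' : ∀ y, inner ℝ (x : EuclideanSpace ℝ (Fin (m + 1))) (ι y) = 0 := fun y => by
    rw [real_inner_comm]; exact hι y
  simp only [inner_sub_left, inner_sub_right, inner_smul_left, inner_smul_right, hι, hι',
    LinearIsometry.inner_map_map, real_inner_self_eq_norm_sq, hx, conj_trivial]
  rw [real_inner_comm y v]
  field_simp
  ring

theorem isRiemannian_roundMetric : IsRiemannian (roundMetric m) := fun x y _ => by
  rw [inChart_roundMetric]
  exact isMetricAt_roundField y

end Sphere

section SmoothPath

theorem contDiff_iteratedFDeriv_snd {E F G : Type*} [NormedAddCommGroup E] [NormedSpace ℝ E]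
    [NormedAddCommGroup F] [NormedSpace ℝ F] [NormedAddCommGroup G] [NormedSpace ℝ G]
    {f : E → F → G} (hf : ContDiff ℝ ∞ (Function.uncurry f)) (j : ℕ) :
    ContDiff ℝ ∞ fun x : E × F => iteratedFDeriv ℝ j (f x.1) x.2 := by
  induction j with
  | zero =>
    exact (continuousMultilinearCurryFin0 ℝ F G).symm.contDiff.comp hf
  | succ j ih =>
    have h1 : ContDiff ℝ ∞ (Function.uncurry fun x : E × F => iteratedFDeriv ℝ j (f x.1)) :=
      ih.comp ((contDiff_fst.comp contDiff_fst).prodMk contDiff_snd)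
    have h2 : ContDiff ℝ ∞ fun x : E × F => fderiv ℝ (iteratedFDeriv ℝ j (f x.1)) x.2 :=
      h1.fderiv contDiff_snd (by simp)
    simp only [iteratedFDeriv_succ_eq_comp_left]
    exact (continuousMultilinearCurryLeftEquiv ℝ (fun _ : Fin (j + 1) => F) G).symm.contDiff.comp h2

variable {E : Type*} [NormedAddCommGroup E] [NormedSpace ℝ E]
  {H : Type*} [TopologicalSpace H] {I : ModelWithCorners ℝ E H}
  {M : Type*} [TopologicalSpace M] [ChartedSpace H M]

/-- A family of functions that depends smoothly on a real parameter and on the chart coordinates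
is a continuous path in the space of smooth functions. -/
theorem tendsto_smoothTopology {f : ℝ → C^∞⟮I, M; ℝ⟯} (t₀ : ℝ)
    (h : ∀ x₀ : M, ContDiff ℝ ∞ fun p : ℝ × E => f p.1 ((extChartAt I x₀).symm p.2)) :
    Filter.Tendsto f (𝓝 t₀) (𝓝 (f t₀)) := by
  rw [nhds_iInf, Filter.tendsto_iInf]
  intro x₀
  rw [nhds_iInf, Filter.tendsto_iInf]
  intro j
  rw [nhds_induced, Filter.tendsto_comap_iff, UniformOnFun.tendsto_iff_tendstoUniformlyOn]
  rintro K ⟨hK, -⟩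
  have hc := (contDiff_iteratedFDeriv_snd (f := fun t y => f t ((extChartAt I x₀).symm y))
    (h x₀) j).continuous
  rw [tendstoUniformlyOn_iff_tendstoUniformly_comp_coe]
  have : CompactSpace K := isCompact_iff_compactSpace.1 hK
  exact Continuous.tendstoUniformly
    (fun t (y : K) => iteratedFDeriv ℝ j (fun y => f t ((extChartAt I x₀).symm y)) y)
    (hc.comp (continuous_fst.prodMk (continuous_subtype_val.comp continuous_snd))) t₀

variable {m : ℕ} {a : EuclideanSpace ℝ (Fin (m + 1))}

theorem abs_div_one_add_sq_le (t : ℝ) : |t / (1 + t ^ 2)| ≤ 1 / 2 := by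
  rw [abs_div, abs_of_pos (by positivity : (0 : ℝ) < 1 + t ^ 2), div_le_iff₀ (by positivity)]
  nlinarith [sq_nonneg (|t| - 1), sq_abs t]

theorem abs_inner_sphere_le (ha : ‖a‖ ≤ 1) (x : Sphere m) : |inner ℝ a x.1| ≤ 1 := by
  have hx : ‖x.1‖ = 1 := by simp
  refine (abs_real_inner_le_norm a x.1).trans ?_
  rw [hx, mul_one]
  exact ha

/-- The factor `u_t = 1 + t / (1 + t²) ⟨a, x⟩`, which is positive for all `t` if `‖a‖ ≤ 1`. -/
def perturbation (a : EuclideanSpace ℝ (Fin (m + 1))) (t : ℝ) (x : Sphere m) : ℝ :=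
  1 + t / (1 + t ^ 2) * inner ℝ a x.1

theorem perturbation_pos (ha : ‖a‖ ≤ 1) (t : ℝ) (x : Sphere m) : 0 < perturbation a t x := by
  have h : |t / (1 + t ^ 2) * inner ℝ a x.1| ≤ 1 / 2 * 1 := by
    rw [abs_mul]
    exact mul_le_mul (abs_div_one_add_sq_le t) (abs_inner_sphere_le ha x) (abs_nonneg _)
      (by norm_num)
  have := (abs_le.1 h).1
  unfold perturbation
  linarith

theorem continuous_perturbation (a : EuclideanSpace ℝ (Fin (m + 1))) (t : ℝ) :
    Continuous (perturbation a t) :=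
  continuous_const.add (continuous_const.mul (continuous_const.inner continuous_subtype_val))

/-- The smooth function `u_t ^ r`. -/
def perturbationRpow (ha : ‖a‖ ≤ 1) (r t : ℝ) : C^∞⟮𝓡 m, Sphere m; ℝ⟯ :=
  ⟨fun x => perturbation a t x ^ r, fun x => by
    have := Fact.mk (@finrank_euclideanSpace_fin ℝ _ (m + 1))
    have h1 : ContDiffAt ℝ ∞ (fun z : EuclideanSpace ℝ (Fin (m + 1)) =>
        (1 + t / (1 + t ^ 2) * inner ℝ a z) ^ r) x.1 :=
      (contDiffAt_const.add (contDiffAt_const.mul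
        (contDiffAt_const.inner ℝ contDiffAt_id))).rpow_const_of_ne (perturbation_pos ha t x).ne'
    exact h1.contMDiffAt.comp x (contMDiff_coe_sphere (m := ∞)).contMDiffAt⟩

/-- In the chart at `x`, linear forms are given by `linearFormLocal`. -/
theorem exists_inner_extChartAt_symm_eq (a : EuclideanSpace ℝ (Fin (m + 1))) (x : Sphere m) :
    ∃ b : EuclideanSpace ℝ (Fin m), ∀ y, inner ℝ a ((extChartAt (𝓡 m) x).symm y).1 =
      linearFormLocal b (inner ℝ a x.1) y := by
  obtain ⟨ι, -, hψ⟩ := exists_extChartAt_sphere_symm_apply x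
  refine ⟨ContinuousLinearMap.adjoint ι.toContinuousLinearMap a, fun y => ?_⟩
  rw [hψ, linearFormLocal, ContinuousLinearMap.adjoint_inner_left]
  simp [inner_sub_right, inner_smul_right]
  ring

theorem tendsto_perturbationRpow (ha : ‖a‖ ≤ 1) (r : ℝ) :
    Filter.Tendsto (perturbationRpow ha r) (𝓝 0) (𝓝 1) := by
  have h1 : perturbationRpow ha r 0 = 1 := by
    ext x
    change perturbation a 0 x ^ r = 1
    simp [perturbation]
  rw [← h1]
  refine tendsto_smoothTopology 0 fun x₀ => ?_
  obtain ⟨b, hb⟩ := exists_inner_extChartAt_symm_eq a x₀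
  refine ContDiff.rpow_const_of_ne (f := fun p : ℝ × EuclideanSpace ℝ (Fin m) =>
    perturbation a p.1 ((extChartAt (𝓡 m) x₀).symm p.2)) ?_ fun p => (perturbation_pos ha _ _).ne'
  simp only [perturbation, hb]
  refine contDiff_const.add (ContDiff.mul (ContDiff.div contDiff_fst ?_ fun p => by positivity)
    ((contDiff_linearFormLocal b _).comp contDiff_snd))
  exact contDiff_const.add (contDiff_fst.pow 2)

end SmoothPath

section Inequality

theorem eventually_quadratic_le_one_add_rpow {p c : ℝ} (hc : 2 * c < p * (p - 1)) :
    ∀ᶠ x in 𝓝 (0 : ℝ), 1 + p * x + c * x ^ 2 ≤ (1 + x) ^ p := by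
  have hd : ∀ (r x : ℝ), -1 < x → HasDerivAt (fun x => (1 + x) ^ r) (r * (1 + x) ^ (r - 1)) x := by
    intro r x hx
    have h := ((hasDerivAt_id x).const_add 1).rpow_const (p := r) (.inl (by simp; linarith))
    simpa using h
  set F : ℝ → ℝ := fun x => (1 + x) ^ p - (1 + p * x + c * x ^ 2) with hF
  have hnhds : ∀ᶠ x in 𝓝 (0 : ℝ), -1 < x := lt_mem_nhds (by norm_num)
  have hF1 : ∀ x, -1 < x → HasDerivAt F (p * (1 + x) ^ (p - 1) - (p + 2 * c * x)) x := by
    intro x hx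
    have h2 : HasDerivAt (fun x : ℝ => 1 + p * x + c * x ^ 2) (p + 2 * c * x) x := by
      have := (((hasDerivAt_id x).const_mul p).const_add 1).add
        (((hasDerivAt_id x).pow 2).const_mul c)
      refine this.congr_deriv ?_
      simp
      ring
    exact (hd p x hx).sub h2
  have hF1' : deriv F =ᶠ[𝓝 0] fun x => p * (1 + x) ^ (p - 1) - (p + 2 * c * x) :=
    hnhds.mono fun x hx => (hF1 x hx).deriv
  have hF2 : HasDerivAt (fun x : ℝ => p * (1 + x) ^ (p - 1) - (p + 2 * c * x))
      (p * (p - 1) - 2 * c) 0 := by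
    have := ((hd (p - 1) 0 (by norm_num)).const_mul p).sub
      (((hasDerivAt_id (0 : ℝ)).const_mul (2 * c)).const_add p)
    refine this.congr_deriv ?_
    simp
  have hmin : IsLocalMin F 0 := by
    refine isLocalMin_of_deriv_deriv_pos ?_ ?_ (hF1 0 (by norm_num)).continuousAt
    · rw [hF1'.deriv_eq, hF2.deriv]
      linarith
    · rw [hF1'.self_of_nhds]
      simp
  filter_upwards [hmin] with x hx
  simp [hF] at hx
  linarith

theorem eventually_linear_lt_rpow {c r b : ℝ} (hb : b < r * c) :
    ∀ᶠ z in 𝓝[>] (0 : ℝ), 1 + b * z < (1 + c * z) ^ r := by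
  have h : HasDerivAt (fun z : ℝ => (1 + c * z) ^ r) (r * c) 0 := by
    have := (((hasDerivAt_id (0 : ℝ)).const_mul c).const_add 1).rpow_const (p := r)
      (.inl (by simp))
    refine this.congr_deriv ?_
    simp
    ring
  have h1 := (hasDerivAt_iff_tendsto_slope.1 h).eventually (lt_mem_nhds hb)
  have h2 : ∀ᶠ z in 𝓝[>] (0 : ℝ), b < slope (fun z : ℝ => (1 + c * z) ^ r) 0 z :=
    h1.filter_mono (nhdsWithin_mono 0 fun z (hz : 0 < z) => hz.ne')
  filter_upwards [h2, self_mem_nhdsWithin] with z hz hz0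
  have hz0 : 0 < z := hz0
  rw [slope_def_field, sub_zero, lt_div_iff₀ hz0] at hz
  simp at hz
  linarith

/-- The second variation of the Yamabe quotient is negative in the direction of `φ`. -/
theorem eventually_quotient_lt {X : Type*} [MeasurableSpace X] [TopologicalSpace X]
    [CompactSpace X] [OpensMeasurableSpace X] {μ : Measure X} [IsFiniteMeasure μ] {φ : X → ℝ}
    (hφ : Continuous φ) (hφ1 : ∀ x, |φ x| ≤ 1) (h0 : ∫ x, φ x ∂μ = 0) (hW : 0 < ∫ x, φ x ^ 2 ∂μ)
    (hV : 0 < μ.real univ) {S A p : ℝ} (hS : 0 < S) (hp : 2 < p) (hA : A < (p - 2) * S) :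
    ∀ᶠ t in 𝓝[≠] (0 : ℝ),
      (S * μ.real univ + t ^ 2 * ((S + A) * ∫ x, φ x ^ 2 ∂μ)) /
        (∫ x, (1 + t * φ x) ^ p ∂μ) ^ (2 / p) < S * μ.real univ / μ.real univ ^ (2 / p) := by
  set V := μ.real univ
  set W := ∫ x, φ x ^ 2 ∂μ
  have hint : ∀ {F : X → ℝ}, Continuous F → Integrable F μ := fun hF =>
    hF.integrable_of_hasCompactSupport (HasCompactSupport.of_compactSpace _)
  set κ := (S + A) / S with hκ
  have hκp : κ < p - 1 := by
    rw [hκ, div_lt_iff₀ hS]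
    nlinarith
  set c := (κ + (p - 1)) * p / 4 with hc
  have hc1 : 2 * c < p * (p - 1) := by nlinarith
  have hc2 : κ < 2 / p * c := by
    rw [hc]
    have : 2 / p * ((κ + (p - 1)) * p / 4) = (κ + (p - 1)) / 2 := by field_simp; ring
    rw [this]
    linarith
  obtain ⟨δ, hδ, hball⟩ := Metric.eventually_nhds_iff_ball.1 (eventually_quadratic_le_one_add_rpow hc1)
  have hlow : ∀ t : ℝ, |t| < min δ 1 → V + c * (t ^ 2 * W) ≤ ∫ x, (1 + t * φ x) ^ p ∂μ := by
    intro t ht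
    have hlt : ∀ x, |t * φ x| < min δ 1 := fun x => by
      rw [abs_mul]
      exact (mul_le_of_le_one_right (abs_nonneg _) (hφ1 x)).trans_lt ht
    have hpos : ∀ x, 0 < 1 + t * φ x := fun x => by
      have := (abs_lt.1 ((hlt x).trans_le (min_le_right _ _))).1
      linarith
    have hcont : Continuous fun x => (1 + t * φ x) ^ p :=
      (continuous_const.add (continuous_const.mul hφ)).rpow_const fun x => .inl (hpos x).ne'
    have hle : ∫ x, (1 + p * (t * φ x) + c * (t * φ x) ^ 2) ∂μ ≤ ∫ x, (1 + t * φ x) ^ p ∂μ := by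
      refine integral_mono (hint (by fun_prop)) (hint hcont) fun x => ?_
      exact hball _ (by simpa using (hlt x).trans_le (min_le_left _ _))
    refine le_trans (le_of_eq ?_) hle
    rw [integral_add (hint (by fun_prop)) (hint (by fun_prop)),
      integral_add (hint (by fun_prop)) (hint (by fun_prop))]
    simp only [mul_pow, integral_const_mul, h0]
    simp [V, W]
  have hz : Filter.Tendsto (fun t : ℝ => t ^ 2 * W / V) (𝓝[≠] 0) (𝓝[>] 0) := by
    refine tendsto_nhdsWithin_iff.2 ⟨?_, ?_⟩
    · have : Continuous fun t : ℝ => t ^ 2 * W / V := by fun_prop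
      exact (this.tendsto' 0 0 (by simp)).mono_left nhdsWithin_le_nhds
    · filter_upwards [self_mem_nhdsWithin] with t ht
      have : t ≠ 0 := ht
      change 0 < t ^ 2 * W / V
      positivity
  have hsmall : ∀ᶠ t in 𝓝[≠] (0 : ℝ), |t| < min δ 1 := by
    refine Filter.Eventually.filter_mono nhdsWithin_le_nhds ?_
    have : Filter.Tendsto (fun t : ℝ => |t|) (𝓝 0) (𝓝 0) := by
      simpa using continuous_abs.tendsto (0 : ℝ)
    exact this.eventually (gt_mem_nhds (by positivity))
  filter_upwards [hz.eventually (eventually_linear_lt_rpow hc2), hsmall, hz self_mem_nhdsWithin,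
    hz.eventually (Filter.Eventually.filter_mono nhdsWithin_le_nhds
      ((continuous_const.add (continuous_const.mul continuous_id) :
        Continuous fun z : ℝ => 1 + c * z).continuousAt.eventually
          (lt_mem_nhds (by simp : (0 : ℝ) < 1 + c * 0))))] with t h1 h2 h3 h4
  have h3 : 0 < t ^ 2 * W / V := h3
  have h4 : 0 < 1 + c * (t ^ 2 * W / V) := h4
  have hVW : V + c * (t ^ 2 * W) = V * (1 + c * (t ^ 2 * W / V)) := by field_simp
  have hpow : V ^ (2 / p) * (1 + c * (t ^ 2 * W / V)) ^ (2 / p) ≤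
      (∫ x, (1 + t * φ x) ^ p ∂μ) ^ (2 / p) := by
    rw [← Real.mul_rpow hV.le h4.le, ← hVW]
    exact Real.rpow_le_rpow (by rw [hVW]; positivity) (hlow t h2) (by positivity)
  have hVp : 0 < V ^ (2 / p) := Real.rpow_pos_of_pos hV _
  have hcp : 0 < (1 + c * (t ^ 2 * W / V)) ^ (2 / p) := Real.rpow_pos_of_pos h4 _
  have hden : 0 < (∫ x, (1 + t * φ x) ^ p ∂μ) ^ (2 / p) := (mul_pos hVp hcp).trans_le hpow
  rw [div_lt_div_iff₀ hden hVp]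
  have hnum : S * V + t ^ 2 * ((S + A) * W) = S * V * (1 + κ * (t ^ 2 * W / V)) := by
    rw [hκ]; field_simp
  rw [hnum]
  calc S * V * (1 + κ * (t ^ 2 * W / V)) * V ^ (2 / p)
      < S * V * (1 + c * (t ^ 2 * W / V)) ^ (2 / p) * V ^ (2 / p) := by gcongr
    _ = S * V * (V ^ (2 / p) * (1 + c * (t ^ 2 * W / V)) ^ (2 / p)) := by ring
    _ ≤ S * V * (∫ x, (1 + t * φ x) ^ p ∂μ) ^ (2 / p) := by gcongr

end Inequality

section ProductWithSphere

variable {k m : ℕ} {M : Type*} [TopologicalSpace M] [ChartedSpace (EuclideanSpace ℝ (Fin k)) M]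
  [IsManifold (𝓡 k) ∞ M]
  (g : Bundle.ContMDiffRiemannianMetric (𝓡 k) ∞ (EuclideanSpace ℝ (Fin k))
    (fun x : M => TangentSpace (𝓡 k) x))

omit [TopologicalSpace M] [ChartedSpace (EuclideanSpace ℝ (Fin k)) M] [IsManifold (𝓡 k) ∞ M] in
theorem finrank_euclideanSpace_prod :
    finrank ℝ (EuclideanSpace ℝ (Fin k) × EuclideanSpace ℝ (Fin m)) = k + m := by
  simp

/-- The scalar curvature of the metrics `u_t^{4/(N-2)} (g + g_0)`. -/
theorem scalarCurvature_perturbation (hkm : 3 ≤ k + m) {a : EuclideanSpace ℝ (Fin (m + 1))}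
    (ha : ‖a‖ ≤ 1) (t : ℝ) (q : M × Sphere m) :
    scalarCurvature (conformal
        (fun q : M × Sphere m => perturbation a t q.2 ^ (4 / (((k + m : ℕ) : ℝ) - 2)))
        (productMetric (formField g) (roundMetric m))) q =
      (perturbation a t q.2 ^ (4 / (((k + m : ℕ) : ℝ) - 2)))⁻¹ *
        (scalarCurvature (formField g) q.1 + m * (m - 1)
          + yamabeCoefficient (k + m) * m * (t / (1 + t ^ 2) * inner ℝ a q.2.1)
            / perturbation a t q.2) := by
  obtain ⟨p, x⟩ := q
  set E := EuclideanSpace ℝ (Fin k)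
  set F := EuclideanSpace ℝ (Fin m)
  obtain ⟨b, hb⟩ := exists_inner_extChartAt_symm_eq a x
  set c : ℝ := inner ℝ a x.1 with hc
  set u : F → ℝ := fun z => 1 + t / (1 + t ^ 2) * linearFormLocal b c z with hu
  have hfr : finrank ℝ (E × F) = k + m := finrank_euclideanSpace_prod
  have hF : finrank ℝ F = m := finrank_euclideanSpace_fin
  have hy0 : extChartAt ((𝓡 k).prod (𝓡 m)) (p, x) (p, x) = (extChartAt (𝓡 k) p p, (0 : F)) := by
    rw [extChartAt_prod, ← extChartAt_sphere_self x]
    rfl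
  have htgt := mem_extChartAt_target (I := (𝓡 k).prod (𝓡 m)) (p, x)
  have hsnd : ∀ y : E × F, ((extChartAt ((𝓡 k).prod (𝓡 m)) (p, x)).symm y).2 =
      (extChartAt (𝓡 m) x).symm y.2 := fun y => by
    rw [extChartAt_prod]; rfl
  have he : inChart (conformal
      (fun q : M × Sphere m => perturbation a t q.2 ^ (4 / (((k + m : ℕ) : ℝ) - 2)))
      (productMetric (formField g) (roundMetric m))) (p, x) =ᶠ[𝓝 (extChartAt (𝓡 k) p p, (0 : F))]
      fun z : E × F => u z.2 ^ (4 / ((finrank ℝ (E × F) : ℝ) - 2)) •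
        productField (inChart (formField g) p) (roundField F) z := by
    rw [hy0] at htgt
    filter_upwards [(isOpen_extChartAt_target (I := (𝓡 k).prod (𝓡 m)) (p, x)).mem_nhds htgt]
      with z hz
    rw [inChart_conformal]
    simp only
    rw [inChart_productMetric _ _ _ _ hz, inChart_roundMetric, hfr, hsnd, perturbation, hb]
  have h1 : IsMetricAt (inChart (formField g) p) (extChartAt (𝓡 k) p p) :=
    isRiemannian_formField g p _ (mem_extChartAt_target p)
  have h2 : IsMetricAt (roundField F) 0 := isMetricAt_roundField 0
  have hsm : ∀ z, ContDiffAt ℝ ∞ u z := fun z =>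
    (contDiff_const.add (contDiff_const.mul (contDiff_linearFormLocal b c))).contDiffAt
  have hsm' : ∀ z : E × F, ContDiffAt ℝ ∞ (fun z : E × F => u z.2) z := fun z =>
    (hsm z.2).comp z contDiffAt_snd
  have hu0 : u 0 = perturbation a t x := by
    have := hb 0
    rw [← extChartAt_sphere_self x, extChartAt_to_inv] at this
    rw [hu, perturbation, ← extChartAt_sphere_self x]
    simp only
    rw [this]
  have hn : 2 < finrank ℝ (E × F) := by omega
  have hscal : scalarCurvature (formField g) p =
    scalarCurvatureLocal (inChart (formField g) p) (extChartAt (𝓡 k) p p) := rfl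
  rw [scalarCurvature, hy0, scalarCurvatureLocal_congr he,
    scalarCurvatureLocal_rpow_smul (IsMetricAt.productField h1 h2) (.of_forall hsm')
      (by rw [hu0]; exact perturbation_pos ha t x) hn,
    scalarCurvatureLocal_productField h1 h2, laplacianLocal_comp_snd h1 h2 (.of_forall hsm),
    laplacianLocal_linearFormLocal, scalarCurvatureLocal_roundField, hfr, ← hscal, hu0, hF]
  simp only [yamabeCoefficient]
  congr 1
  push_cast
  ring

variable [CompactSpace M] [Nonempty M] [MeasurableSpace M] [BorelSpace M]

omit [IsManifold (𝓡 k) ∞ M] [CompactSpace M] [Nonempty M] in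
/-- Integration with respect to the metric `u_t^{4/(N-2)} G`. -/
theorem integral_volumeMeasure_perturbation (hkm : 3 ≤ k + m)
    {a : EuclideanSpace ℝ (Fin (m + 1))} (ha : ‖a‖ ≤ 1) (t : ℝ)
    {G : FormField ((𝓡 k).prod (𝓡 m)) (M × Sphere m)} (hG : IsRiemannian G)
    (F : M × Sphere m → ℝ) :
    ∫ q, F q ∂(volumeMeasure (conformal
        (fun q : M × Sphere m => perturbation a t q.2 ^ (4 / (((k + m : ℕ) : ℝ) - 2))) G)) =
      ∫ q, perturbation a t q.2 ^ criticalExponent (k + m) * F q ∂(volumeMeasure G) := by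
  have hn3 : (3 : ℝ) ≤ ((k + m : ℕ) : ℝ) := by exact_mod_cast hkm
  have hupos : ∀ q : M × Sphere m, 0 < perturbation a t q.2 := fun q => perturbation_pos ha t q.2
  have hcont : Continuous fun q : M × Sphere m =>
      perturbation a t q.2 ^ (4 / (((k + m : ℕ) : ℝ) - 2)) :=
    ((continuous_perturbation a t).comp continuous_snd).rpow_const fun q => .inl (hupos q).ne'
  have hI := hG.integral_volumeMeasure_conformal hcont
    (fun q => Real.rpow_pos_of_pos (hupos q) _) F
  rw [hI]
  refine integral_congr_ae (.of_forall fun q => ?_)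
  simp only
  rw [← Real.rpow_mul (hupos q).le, finrank_euclideanSpace_prod, criticalExponent]
  congr 2
  have : ((k + m : ℕ) : ℝ) - 2 ≠ 0 := by linarith
  field_simp
  ring

theorem integral_quadratic {X : Type*} [MeasurableSpace X] [TopologicalSpace X]
    [CompactSpace X] [OpensMeasurableSpace X] {μ : Measure X} [IsFiniteMeasure μ] {φ : X → ℝ}
    (hφ : Continuous φ) (h0 : ∫ x, φ x ∂μ = 0) (b₀ b₁ b₂ : ℝ) :
    ∫ x, (b₀ + b₁ * φ x + b₂ * φ x ^ 2) ∂μ = b₀ * μ.real univ + b₂ * ∫ x, φ x ^ 2 ∂μ := by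
  have hint : ∀ {F : X → ℝ}, Continuous F → Integrable F μ := fun hF =>
    hF.integrable_of_hasCompactSupport (HasCompactSupport.of_compactSpace _)
  rw [integral_add (hint (by fun_prop)) (hint (by fun_prop)),
    integral_add (hint (by fun_prop)) (hint (by fun_prop)), integral_const_mul,
    integral_const_mul, h0, integral_const, smul_eq_mul]
  ring

omit [CompactSpace M] [Nonempty M] [MeasurableSpace M] [BorelSpace M] in
theorem perturbation_rpow_mul_scalarCurvature (hkm : 3 ≤ k + m)
    {a : EuclideanSpace ℝ (Fin (m + 1))} (ha : ‖a‖ ≤ 1) {s : ℝ}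
    (hs : ∀ x, scalarCurvature (formField g) x = s) (t : ℝ) (q : M × Sphere m) :
    perturbation a t q.2 ^ criticalExponent (k + m) * scalarCurvature (conformal
        (fun q : M × Sphere m => perturbation a t q.2 ^ (4 / (((k + m : ℕ) : ℝ) - 2)))
        (productMetric (formField g) (roundMetric m))) q =
      (s + m * (m - 1))
        + (t / (1 + t ^ 2) * (2 * (s + m * (m - 1)) + yamabeCoefficient (k + m) * m))
          * inner ℝ a q.2.1
        + ((t / (1 + t ^ 2)) ^ 2 * (s + m * (m - 1) + yamabeCoefficient (k + m) * m))
          * inner ℝ a q.2.1 ^ 2 := by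
  have hupos : 0 < perturbation a t q.2 := perturbation_pos ha t q.2
  have hn3 : (3 : ℝ) ≤ ((k + m : ℕ) : ℝ) := by exact_mod_cast hkm
  have hpow : perturbation a t q.2 ^ criticalExponent (k + m) *
      (perturbation a t q.2 ^ (4 / (((k + m : ℕ) : ℝ) - 2)))⁻¹ = perturbation a t q.2 ^ 2 := by
    rw [← Real.rpow_neg hupos.le, ← Real.rpow_add hupos, ← Real.rpow_natCast, criticalExponent]
    congr 1
    have : ((k + m : ℕ) : ℝ) - 2 ≠ 0 := by linarith
    field_simp
    push_cast
    ring
  rw [scalarCurvature_perturbation g hkm ha, ← mul_assoc, hpow, hs]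
  have hu : perturbation a t q.2 = 1 + t / (1 + t ^ 2) * inner ℝ a q.2.1 := rfl
  generalize t / (1 + t ^ 2) = τ at hu ⊢
  generalize yamabeCoefficient (k + m) = A
  generalize (inner ℝ a q.2.1 : ℝ) = φ at hu ⊢
  generalize perturbation a t q.2 = u at hu hupos ⊢
  field_simp
  rw [hu]
  ring

omit [Nonempty M] in
theorem totalScalarCurvature_perturbation (hkm : 3 ≤ k + m) {a : EuclideanSpace ℝ (Fin (m + 1))}
    (ha : ‖a‖ ≤ 1) {s : ℝ} (hs : ∀ x, scalarCurvature (formField g) x = s)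
    (h0 : ∫ q : M × Sphere m, inner ℝ a q.2.1
      ∂(volumeMeasure (productMetric (formField g) (roundMetric m))) = 0) (t : ℝ) :
    totalScalarCurvature (conformal
        (fun q : M × Sphere m => perturbation a t q.2 ^ (4 / (((k + m : ℕ) : ℝ) - 2)))
        (productMetric (formField g) (roundMetric m))) =
      ((s + m * (m - 1)) * (volumeMeasure (productMetric (formField g) (roundMetric m))).real univ
        + (t / (1 + t ^ 2)) ^ 2 * ((s + m * (m - 1) + yamabeCoefficient (k + m) * m) *
          ∫ q : M × Sphere m, (inner ℝ a q.2.1) ^ 2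
            ∂(volumeMeasure (productMetric (formField g) (roundMetric m))))) /
      (∫ q : M × Sphere m, (1 + t / (1 + t ^ 2) * inner ℝ a q.2.1) ^ criticalExponent (k + m)
        ∂(volumeMeasure (productMetric (formField g) (roundMetric m)))) ^
          (2 / criticalExponent (k + m)) := by
  have hR : IsRiemannian (productMetric (formField g) (roundMetric m)) :=
    (isRiemannian_formField g).productMetric isRiemannian_roundMetric
  have := hR.isLocallyFiniteMeasure
  have hn3 : (3 : ℝ) ≤ ((k + m : ℕ) : ℝ) := by exact_mod_cast hkm
  have hI := integral_volumeMeasure_perturbation hkm ha t hR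
  have hφc : Continuous fun q : M × Sphere m => (inner ℝ a q.2.1 : ℝ) :=
    continuous_const.inner (continuous_subtype_val.comp continuous_snd)
  have hvol := hI fun _ => 1
  rw [integral_const, smul_eq_mul, mul_one] at hvol
  simp only [mul_one] at hvol
  have hexp : (((k + m : ℕ) : ℝ) - 2) / ((k + m : ℕ) : ℝ) = 2 / criticalExponent (k + m) := by
    have : ((k + m : ℕ) : ℝ) - 2 ≠ 0 := by linarith
    have : ((k + m : ℕ) : ℝ) ≠ 0 := by linarith
    rw [criticalExponent]
    field_simp
  rw [totalScalarCurvature, finrank_euclideanSpace_prod, hI, hvol, hexp]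
  simp only [perturbation_rpow_mul_scalarCurvature g hkm ha hs]
  rw [integral_quadratic hφc h0, mul_assoc (_ ^ 2)]
  rfl

/-- There is a linear form of norm one on the ambient space of the sphere with mean value zero. -/
theorem exists_integral_inner_eq_zero (hm : 1 ≤ m) {X : Type*} [MeasurableSpace X]
    (μ : Measure X) (f : X → EuclideanSpace ℝ (Fin (m + 1))) (hf : Integrable f μ) :
    ∃ a : EuclideanSpace ℝ (Fin (m + 1)), ‖a‖ = 1 ∧ ∫ x, inner ℝ a (f x) ∂μ = 0 := by
  have h : finrank ℝ ℝ < finrank ℝ (EuclideanSpace ℝ (Fin (m + 1))) := by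
    simp
    omega
  obtain ⟨v, hv, hv0⟩ := Submodule.exists_mem_ne_zero_of_ne_bot
    (LinearMap.ker_ne_bot_of_finrank_lt (f := (innerSL ℝ (∫ x, f x ∂μ) :
      EuclideanSpace ℝ (Fin (m + 1)) →L[ℝ] ℝ).toLinearMap) h)
  refine ⟨‖v‖⁻¹ • v, ?_, ?_⟩
  · rw [norm_smul, norm_inv, norm_norm, inv_mul_cancel₀ (norm_ne_zero_iff.2 hv0)]
  · have hv' : inner ℝ (∫ x, f x ∂μ) v = 0 := hv
    rw [integral_inner hf, real_inner_smul_left, real_inner_comm, hv', mul_zero]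

/-- There are metrics arbitrarily close to `g + g_0` with smaller total scalar curvature. -/
theorem exists_tendsto_totalScalarCurvature_lt (hm : 1 ≤ m) (hkm : 3 ≤ k + m) {s : ℝ}
    (hs : ∀ x, scalarCurvature (formField g) x = s)
    (h : s + m * (m - 1) > yamabeCoefficient (k + m) * m / (criticalExponent (k + m) - 2)) :
    ∃ f : ℝ → C^∞⟮𝓡 m, Sphere m; ℝ⟯, (∀ t x, 0 < f t x) ∧ Filter.Tendsto f (𝓝[≠] 0) (𝓝 1) ∧
      ∀ᶠ t in 𝓝[≠] 0, totalScalarCurvature (conformal (fun q : M × Sphere m => f t q.2)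
        (productMetric (formField g) (roundMetric m))) <
          totalScalarCurvature (productMetric (formField g) (roundMetric m)) := by
  set G := productMetric (formField g) (roundMetric m) with hG
  have hR : IsRiemannian G := (isRiemannian_formField g).productMetric isRiemannian_roundMetric
  have := hR.isLocallyFiniteMeasure
  have := hR.isOpenPosMeasure
  have hint : ∀ {V : Type} [NormedAddCommGroup V] {F : M × Sphere m → V}, Continuous F →
      Integrable F (volumeMeasure G) := fun hF =>
    hF.integrable_of_hasCompactSupport (HasCompactSupport.of_compactSpace _)
  obtain ⟨a, ha, h0⟩ := exists_integral_inner_eq_zero hm (volumeMeasure G)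
    (fun q : M × Sphere m => q.2.1) (hint (continuous_subtype_val.comp continuous_snd))
  have hn3 : (3 : ℝ) ≤ ((k + m : ℕ) : ℝ) := by exact_mod_cast hkm
  have hm1 : (1 : ℝ) ≤ m := by exact_mod_cast hm
  have hp : 2 < criticalExponent (k + m) := by
    rw [criticalExponent, lt_div_iff₀ (by linarith)]
    linarith
  have hA : yamabeCoefficient (k + m) * m <
      (criticalExponent (k + m) - 2) * (s + m * (m - 1)) := by
    rw [gt_iff_lt, div_lt_iff₀ (by linarith)] at h
    linarith
  have hA0 : 0 < yamabeCoefficient (k + m) * m := by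
    rw [yamabeCoefficient]
    have : 0 < ((k + m : ℕ) : ℝ) - 1 := by linarith
    have : 0 < ((k + m : ℕ) : ℝ) - 2 := by linarith
    positivity
  have hS : 0 < s + m * (m - 1) := by
    have := hA0.trans hA
    exact (mul_pos_iff_of_pos_left (by linarith)).1 this
  set φ : M × Sphere m → ℝ := fun q => inner ℝ a q.2.1 with hφ
  have hφc : Continuous φ := continuous_const.inner (continuous_subtype_val.comp continuous_snd)
  have hφ1 : ∀ q, |φ q| ≤ 1 := fun q => abs_inner_sphere_le ha.le q.2
  let q₀ : M × Sphere m := (Classical.arbitrary M, ⟨a, by simpa using ha⟩)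
  have hW : 0 < ∫ q, φ q ^ 2 ∂(volumeMeasure G) := by
    refine (hφc.pow 2).integral_pos_of_hasCompactSupport_nonneg_nonzero
      (HasCompactSupport.of_compactSpace _) (fun q => sq_nonneg _) (x := q₀) ?_
    change (inner ℝ a a : ℝ) ^ 2 ≠ 0
    rw [real_inner_self_eq_norm_sq, ha]
    norm_num
  have hV : 0 < (volumeMeasure G).real univ := by
    refine ENNReal.toReal_pos ?_ (measure_ne_top _ _)
    exact (isOpen_univ.measure_pos (volumeMeasure G) ⟨q₀, trivial⟩).ne'
  have htot := totalScalarCurvature_perturbation g hkm ha.le hs h0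
  rw [← hG] at htot
  refine ⟨perturbationRpow ha.le (4 / (((k + m : ℕ) : ℝ) - 2)), fun t x => ?_,
    (tendsto_perturbationRpow ha.le _).mono_left nhdsWithin_le_nhds, ?_⟩
  · exact Real.rpow_pos_of_pos (perturbation_pos ha.le t x) _
  have hone : totalScalarCurvature G = (s + m * (m - 1)) * (volumeMeasure G).real univ /
      (volumeMeasure G).real univ ^ (2 / criticalExponent (k + m)) := by
    have h1 := htot 0
    have h2 : conformal (fun q : M × Sphere m =>
        perturbation a 0 q.2 ^ (4 / (((k + m : ℕ) : ℝ) - 2))) G = G := by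
      funext q
      have : perturbation a 0 q.2 ^ (4 / (((k + m : ℕ) : ℝ) - 2)) = 1 := by simp [perturbation]
      simp only [conformal, this, one_smul]
    rw [h2] at h1
    rw [h1]
    simp
  have hτ : Filter.Tendsto (fun t : ℝ => t / (1 + t ^ 2)) (𝓝[≠] 0) (𝓝[≠] 0) := by
    refine tendsto_nhdsWithin_iff.2 ⟨?_, ?_⟩
    · have : Continuous fun t : ℝ => t / (1 + t ^ 2) :=
        continuous_id.div (by fun_prop) fun t => by positivity
      exact (this.tendsto' 0 0 (by simp)).mono_left nhdsWithin_le_nhds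
    · filter_upwards [self_mem_nhdsWithin] with t ht
      exact div_ne_zero ht (by positivity)
  have hlt := hτ.eventually (eventually_quotient_lt hφc hφ1 h0 hW hV hS hp hA)
  filter_upwards [hlt] with t ht
  change totalScalarCurvature (conformal (fun q : M × Sphere m =>
    perturbation a t q.2 ^ (4 / (((k + m : ℕ) : ℝ) - 2))) G) < totalScalarCurvature G
  rw [htot t, hone]
  exact ht

end ProductWithSphere

end RiemannianYamabe

end

open RiemannianYamabe in
theorem theorem1p2 (k m : ℕ) (hm : 1 ≤ m) (hkm : 3 ≤ k + m)
    {M : Type*} [TopologicalSpace M] [T2Space M] [CompactSpace M] [Nonempty M]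
    [ChartedSpace (EuclideanSpace ℝ (Fin k)) M] [IsManifold (𝓡 k) ∞ M]
    [MeasurableSpace M] [BorelSpace M]
    (g : Bundle.ContMDiffRiemannianMetric (𝓡 k) ∞ (EuclideanSpace ℝ (Fin k))
      (fun x : M => TangentSpace (𝓡 k) x))
    (s : ℝ) (hs : ∀ x, scalarCurvature (formField g) x = s)
    (h : s + m * (m - 1) >
      yamabeCoefficient (k + m) * m / (criticalExponent (k + m) - 2)) :
    ¬ IsYamabeMetric (productMetric (formField g) (roundMetric m)) ∧
    ¬ IsLocalMinOn
      (fun f : C^∞⟮𝓡 m, Sphere m; ℝ⟯ => totalScalarCurvature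
        (conformal (fun q : M × Sphere m => f q.2) (productMetric (formField g) (roundMetric m))))
      {f | ∀ x, 0 < f x} 1 := by
  obtain ⟨f, hpos, htend, hlt⟩ := exists_tendsto_totalScalarCurvature_lt g hm hkm hs h
  constructor
  · intro hY
    obtain ⟨t, ht⟩ := hlt.exists
    have hle := hY (a := conformal (fun q : M × Sphere m => f t q.2)
      (productMetric (formField g) (roundMetric m)))
      ⟨(f t).comp ⟨Prod.snd, contMDiff_snd⟩, fun q => hpos t q.2, rfl⟩
    exact absurd ht (not_lt.2 hle)
  · intro hmin
    have h1 : Filter.Tendsto f (𝓝[≠] 0) (𝓝[{f | ∀ x, 0 < f x}] 1) :=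
      tendsto_nhdsWithin_iff.2 ⟨htend, .of_forall hpos⟩
    obtain ⟨t, ht, ht'⟩ := (hlt.and (h1.eventually hmin)).exists
    have h2 : conformal (fun q : M × Sphere m => (1 : C^∞⟮𝓡 m, Sphere m; ℝ⟯) q.2)
        (productMetric (formField g) (roundMetric m)) =
        productMetric (formField g) (roundMetric m) := by
      funext q
      change (1 : ℝ) • _ = _
      rw [one_smul]
    have h3 : totalScalarCurvature (conformal
        (fun q : M × Sphere m => (1 : C^∞⟮𝓡 m, Sphere m; ℝ⟯) q.2)
        (productMetric (formField g) (roundMetric m))) ≤ _ := ht'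
    rw [h2] at h3
    exact absurd ht (not_lt.2 h3)
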